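/- Let $n\ge 1$, let $\theta=(\theta_{jk})_{j,k=1}^n$ be a real skew-symmetric matrix, let $d\ge 1$ be an integer and let $1\le p\le\infty$. Let $\mathcal A_\theta$ be the quantum torus, i.e. the universal $C^*$-algebra generated by $n$ unitaries $U_1,\dots,U_n$ with $U_jU_k=e^{2\pi i\theta_{jk}}U_kU_j$ for all $j,k$. For $\alpha\in\mathbb Z^n$ put $U^\alpha=U_1^{\alpha_1}\cdots U_n^{\alpha_n}$ and $|\alpha|=\sum_{j=1}^n|\alpha_j|$. Let $\tau_\theta$ be the canonical tracial state on $\mathcal A_\theta$, determined by $\tau_\theta\big(\sum_\alpha x_\alpha U^\alpha\big)=x_0$ on polynomials (finite sums) $\sum_{\alpha\in\mathbb Z^n} x_\alpha U^\alpha$, $x_\alpha\in\mathbb C$; let $\mathbb T_\theta$ be the von Neumann algebra generated by $\mathcal A_\theta$ in the GNS representation of $\tau_\theta$, with $\tau_\theta$ also denoting its canonical trace, and let $\|x\|_p=\tau_\theta\big((x^*x)^{p/2}\big)^{1/p}$ for $p<\infty$ and $\|x\|_\infty$ the operator norm, $x\in\mathbb T_\theta$. On polynomials define $$P_t\Big(\sum_\alpha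 x_\alpha U^\alpha\Big)=\sum_\alpha e^{-t|\alpha|}x_\alpha U^\alpha\quad(t\ge 0),\qquad L\Big(\sum_\alpha x_\alpha U^\alpha\Big)=\sum_\alpha |\alpha|\,x_\alpha U^\alpha .$$ Let $\mathcal P^{\ge d}$ (resp. $\mathcal P^{\le d}$) be the linear span of the $U^\alpha$ with $|\alpha|\ge d$ (resp. $|\alpha|\le d$), $\alpha\in\mathbb Z^n$. Call a polynomial holomorphic if it is a finite linear combination of the $U^\alpha$ with $\alpha\in\mathbb N^n$, where $\mathbb N=\{0,1,2,\dots\}$. Then for every holomorphic polynomial $x$: (i) if $x\in\mathcal P^{\ge d}$, then $\|P_t(x)\|_p\le e^{-td}\|x\|_p$ for all $t\ge 0$, and $\|L(x)\|_p\ge d\,\|x\|_p$; (ii) if $x\in\mathcal P^{\le d}$, then $\|L(x)\|_p\le d\,\|x\|_p$, and $\|P_t(x)\|_p\ge e^{-td}\|x\|_p$ for all $t\ge 0$. These inequalities are sharp: there is a holomorphic polynomial $x\in\mathcal P^{\ge d}\cap\mathcal P^{\le d}$ with $\|x\|_p>0$ for which all of them are equalities. -/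

import Mathlib

open scoped ENNReal InnerProductSpace Matrix ComplexOrder

noncomputable section

namespace QTorus

/-- Real skew-symmetric `n × n` matrices. -/
abbrev SkewMatrix (n : ℕ) : Type := {θ : Matrix (Fin n) (Fin n) ℝ // θᵀ = -θ}

/-- A (nonzero unital) C⋆-algebra together with unitaries `u 0, …, u (n-1)` satisfying
`u j * u k = e ^ (2 π i θ j k) * (u k * u j)`. Since a C⋆-algebra generated by `n` elements is
separable, algebras in `Type` give all such tuples up to isomorphism. -/
structure Realization {n : ℕ} (θ : SkewMatrix n) : Type 1 where
  /-- the underlying C⋆-algebra -/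
  A : Type
  [cstar : CStarAlgebra A]
  [nontriv : Nontrivial A]
  /-- the unitaries -/
  u : Fin n → unitary A
  rel : ∀ j k, (u j : A) * (u k : A) =
    Complex.exp (2 * Real.pi * Complex.I * θ.1 j k) • ((u k : A) * (u j : A))

attribute [instance] Realization.cstar Realization.nontriv

variable {n : ℕ} (θ : SkewMatrix n)

/-- The C⋆-algebra of all uniformly bounded families `(a ρ)`, `a ρ ∈ ρ.A`, indexed by all
realizations of the commutation relations. -/
abbrev BigProduct : Type 1 := lp (fun ρ : Realization θ => ρ.A) ∞

instance : CStarAlgebra (BigProduct θ) where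
  __ := lp.inftyNormedRing
  __ := (inferInstance : NonUnitalCStarAlgebra (BigProduct θ))
  __ := (inferInstance : NormedAlgebra ℂ (BigProduct θ))

/-- Evaluation at one realization. -/
def coordHom (ρ : Realization θ) : BigProduct θ →⋆ₐ[ℂ] ρ.A where
  toFun f := f ρ
  map_one' := rfl
  map_mul' _ _ := rfl
  map_zero' := rfl
  map_add' _ _ := rfl
  commutes' _ := rfl
  map_star' _ := rfl


/-- The tuple `j ↦ (u j)_ρ` of unitaries in the product of all realizations. -/
def bigU (j : Fin n) : unitary (BigProduct θ) :=
  ⟨⟨fun ρ => (ρ.u j : ρ.A), memℓp_infty ⟨1, by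
      rintro _ ⟨ρ, rfl⟩
      exact (CStarRing.norm_coe_unitary (ρ.u j)).le⟩⟩, by
    rw [Unitary.mem_iff]
    constructor
    · ext ρ
      exact Unitary.coe_star_mul_self (ρ.u j)
    · ext ρ
      exact Unitary.coe_mul_star_self (ρ.u j)⟩

/-- The C⋆-subalgebra generated by the universal tuple. -/
def generatedSubalgebra : StarSubalgebra ℂ (BigProduct θ) :=
  (StarAlgebra.adjoin ℂ (Set.range fun j => (bigU θ j : BigProduct θ))).topologicalClosure

instance : IsClosed (generatedSubalgebra θ : Set (BigProduct θ)) :=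
  StarSubalgebra.isClosed_topologicalClosure _

/-- The quantum torus: the universal C⋆-algebra generated by unitaries `U j` with
`U j * U k = e ^ (2 π i θ j k) * (U k * U j)`, realized inside the product of all realizations
of these relations. The universal property is given by `toRealization`. -/
def QuantumTorus : Type 1 := generatedSubalgebra θ

instance : CStarAlgebra (QuantumTorus θ) :=
  inferInstanceAs (CStarAlgebra (generatedSubalgebra θ))

instance : PartialOrder (QuantumTorus θ) := CStarAlgebra.spectralOrder _

instance : StarOrderedRing (QuantumTorus θ) := CStarAlgebra.spectralOrderedRing _

/-- The canonical unitary generators. -/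
def U (j : Fin n) : unitary (QuantumTorus θ) :=
  ⟨(⟨bigU θ j, StarSubalgebra.le_topologicalClosure _
      (StarAlgebra.subset_adjoin ℂ _ ⟨j, rfl⟩)⟩ : generatedSubalgebra θ),
    Unitary.mem_iff.2 ⟨Subtype.ext (Unitary.coe_star_mul_self (bigU θ j)),
      Subtype.ext (Unitary.coe_mul_star_self (bigU θ j))⟩⟩

/-- The canonical homomorphism onto a realization; it sends `U j` to `ρ.u j`. -/
def toRealization (ρ : Realization θ) : QuantumTorus θ →⋆ₐ[ℂ] ρ.A :=
  (coordHom θ ρ).comp (generatedSubalgebra θ).subtype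

lemma toRealization_U (ρ : Realization θ) (j : Fin n) :
    toRealization θ ρ (U θ j : QuantumTorus θ) = ρ.u j := rfl

lemma U_relation (j k : Fin n) :
    (U θ j : QuantumTorus θ) * (U θ k : QuantumTorus θ) =
      Complex.exp (2 * Real.pi * Complex.I * θ.1 j k) •
        ((U θ k : QuantumTorus θ) * (U θ j : QuantumTorus θ)) := by
  apply Subtype.ext
  ext ρ
  exact ρ.rel j k

/-- `U ^ α = U_1 ^ α_1 ⋯ U_n ^ α_n`, in this order. -/
def monomial (α : Fin n → ℤ) : QuantumTorus θ :=
  ((List.ofFn fun j => U θ j ^ α j).prod : unitary (QuantumTorus θ))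

/-! ### The regular representation -/

/-- The Hilbert space `ℓ²(ℤⁿ)`. -/
abbrev Ell2 (n : ℕ) : Type := lp (fun _ : Fin n → ℤ => ℂ) 2

/-- The weighted permutation operator `(T f) β = w β * f (σ β)` with unimodular weight `w`. -/
def weightedPerm (σ : Equiv.Perm (Fin n → ℤ)) (w : (Fin n → ℤ) → ℂ) (hw : ∀ β, ‖w β‖ = 1) :
    Ell2 n →ₗᵢ[ℂ] Ell2 n where
  toFun f := ⟨fun β => w β * f (σ β), by
    have hf := lp.memℓp f
    change Memℓp _ _
    rw [memℓp_gen_iff (by norm_num)] at hf ⊢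
    simpa [hw, Function.comp_def] using (Equiv.summable_iff σ).2 hf⟩
  map_add' f g := by
    ext β
    exact mul_add _ _ _
  map_smul' c f := by
    ext β
    exact mul_left_comm _ _ _
  norm_map' f := by
    have h2 : 0 < (2 : ℝ≥0∞).toReal := by norm_num
    rw [lp.norm_eq_tsum_rpow h2, lp.norm_eq_tsum_rpow h2]
    congr 1
    simpa [hw] using Equiv.tsum_eq σ (fun β => ‖f β‖ ^ (2 : ℝ≥0∞).toReal)

/-- `weightedPerm` as a unitary operator. -/
def weightedPermEquiv (σ : Equiv.Perm (Fin n → ℤ)) (w : (Fin n → ℤ) → ℂ)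
    (hw : ∀ β, ‖w β‖ = 1) : Ell2 n ≃ₗᵢ[ℂ] Ell2 n :=
  LinearIsometryEquiv.ofSurjective (weightedPerm σ w hw) fun g =>
    ⟨weightedPerm σ.symm (fun β => (w (σ.symm β))⁻¹) (by simp [hw]) g, by
      ext β
      have h : w β ≠ 0 := norm_ne_zero_iff.1 (by simp [hw])
      change w β * ((w (σ.symm (σ β)))⁻¹ * g (σ.symm (σ β))) = g β
      simp [h]⟩

/-- The phase `∑_{k < j} θ j k * α k`. -/
def phase (j : Fin n) (α : Fin n → ℤ) : ℝ :=
  ∑ k ∈ Finset.univ.filter (· < j), θ.1 j k * α k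

/-- The `j`-th twisted translation on `ℓ²(ℤⁿ)`:
`δ_α ↦ e ^ (2 π i ∑_{k < j} θ j k * α k) δ_{α + e_j}`. -/
def regularU (j : Fin n) : unitary (Ell2 n →L[ℂ] Ell2 n) :=
  Unitary.linearIsometryEquiv.symm (weightedPermEquiv (Equiv.subRight (Pi.single j 1))
    (fun β => Complex.exp (2 * Real.pi * Complex.I * phase θ j (β - Pi.single j 1)))
    fun β => by simp [Complex.norm_exp])

lemma regularU_apply (j : Fin n) (f : Ell2 n) (β : Fin n → ℤ) :
    (regularU θ j : Ell2 n →L[ℂ] Ell2 n) f β =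
      Complex.exp (2 * Real.pi * Complex.I * phase θ j (β - Pi.single j 1)) *
        f (β - Pi.single j 1) := rfl

lemma phase_sub (j k : Fin n) (β : Fin n → ℤ) :
    phase θ j (β - Pi.single k 1) = phase θ j β - if k < j then θ.1 j k else 0 := by
  simp only [phase, Pi.sub_apply, Pi.single_apply]
  push_cast
  simp [mul_sub, Finset.sum_sub_distrib, Finset.sum_filter]

lemma regularU_rel (j k : Fin n) :
    (regularU θ j : Ell2 n →L[ℂ] Ell2 n) * (regularU θ k : Ell2 n →L[ℂ] Ell2 n) =
    Complex.exp (2 * Real.pi * Complex.I * θ.1 j k) •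
      ((regularU θ k : Ell2 n →L[ℂ] Ell2 n) * (regularU θ j : Ell2 n →L[ℂ] Ell2 n)) := by
  ext f β
  have hskew : θ.1 k j = - θ.1 j k := by
    have := congrFun (congrFun θ.2 j) k
    simpa using this
  have hsub : β - Pi.single k 1 - Pi.single j 1 = β - Pi.single j 1 - Pi.single k (1 : ℤ) :=
    sub_right_comm _ _ _
  simp only [mul_apply_eq_comp, regularU_apply, smul_apply,
    lp.coeFn_smul, Pi.smul_apply, smul_eq_mul, hsub, ← mul_assoc, ← Complex.exp_add]
  congr 2
  simp only [phase_sub]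
  rcases lt_trichotomy j k with h | h | h
  · simp [h, h.not_gt, hskew]
    ring
  · subst h
    have : θ.1 j j = 0 := by linarith
    simp [this]
  · simp [h, h.not_gt]
    ring

instance : Nontrivial (Ell2 n) :=
  ⟨⟨lp.single 2 0 1, 0, fun h => by
    have := congrArg (fun f : Ell2 n => f 0) h
    simp at this⟩⟩

/-- The twisted regular representation on `ℓ²(ℤⁿ)`. -/
def regular : Realization θ where
  A := Ell2 n →L[ℂ] Ell2 n
  u := regularU θ
  rel := regularU_rel θ

/-- The basis vector `δ_α` of `ℓ²(ℤⁿ)`. -/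
def delta (α : Fin n → ℤ) : Ell2 n := lp.single 2 α 1


/-! ### The trace -/

/-- The twisted regular representation as a ⋆-homomorphism. -/
def regularHom : QuantumTorus θ →⋆ₐ[ℂ] (Ell2 n →L[ℂ] Ell2 n) := toRealization θ (regular θ)

/-- The canonical trace, as a positive functional: `τ a = ⟨δ_0, a δ_0⟩` in the regular
representation. It is the continuous functional with `τ (∑ x_α U ^ α) = x_0`;
see `trace_monomial`. -/
def trace : QuantumTorus θ →ₚ[ℂ] ℂ :=
  PositiveLinearMap.mk₀
    { toFun := fun a => ⟪delta 0, regularHom θ a (delta 0)⟫_ℂ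
      map_add' := fun a b => by
        rw [map_add]
        exact inner_add_right _ _ _
      map_smul' := fun c a => by
        rw [map_smul]
        exact inner_smul_right _ _ _ }
    fun a ha => by
      obtain ⟨b, rfl⟩ := CStarAlgebra.nonneg_iff_eq_star_mul_self.1 ha
      change 0 ≤ ⟪delta 0, regularHom θ (star b * b) (delta 0)⟫_ℂ
      rw [map_mul, map_star, mul_apply_eq_comp, ContinuousLinearMap.star_eq_adjoint,
        ContinuousLinearMap.adjoint_inner_right, inner_self_eq_norm_sq_to_K]
      positivity

lemma trace_apply (a : QuantumTorus θ) :
    trace θ a = ⟪delta 0, regularHom θ a (delta 0)⟫_ℂ := rfl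

lemma regularU_delta (j : Fin n) (α : Fin n → ℤ) (h : ∀ k < j, α k = 0) :
    (regularU θ j : Ell2 n →L[ℂ] Ell2 n) (delta α) = delta (α + Pi.single j 1) := by
  ext β
  rw [regularU_apply]
  by_cases hβ : β = α + Pi.single j 1
  · subst hβ
    have hp : phase θ j α = 0 :=
      Finset.sum_eq_zero fun k hk => by simp [h k (Finset.mem_filter.1 hk).2]
    simp [delta, hp]
  · have : β - Pi.single j 1 ≠ α := fun h => hβ (by rw [← h]; simp)
    simp [delta, lp.single_apply, hβ, this]

lemma regularU_zpow_delta (j : Fin n) (m : ℤ) (α : Fin n → ℤ) (h : ∀ k < j, α k = 0) :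
    ((regularU θ j ^ m : unitary (Ell2 n →L[ℂ] Ell2 n)) : Ell2 n →L[ℂ] Ell2 n) (delta α) =
      delta (α + Pi.single j m) := by
  have hl : ∀ c : ℤ, ∀ k < j, (α + (Pi.single j c : Fin n → ℤ)) k = 0 := fun c k hk => by
    simp [h k hk, hk.ne]
  induction m with
  | zero => simp
  | succ i ih =>
    rw [add_comm, zpow_add, zpow_one, Submonoid.coe_mul, mul_apply_eq_comp, ih,
      regularU_delta θ j _ (hl _), add_assoc, ← Pi.single_add, add_comm (i : ℤ)]
  | pred i ih =>
    have hi : (-(i : ℤ) - 1) = -1 + -i := by ring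
    have key := regularU_delta θ j _ (hl (-1 + -i))
    rw [hi, zpow_add, zpow_neg, zpow_one, Submonoid.coe_mul, mul_apply_eq_comp, ih]
    have h2 : α + Pi.single j (-1 + -(i : ℤ)) + Pi.single j 1 = α + Pi.single j (-(i : ℤ)) := by
      rw [add_assoc, ← Pi.single_add]
      congr 2
      ring
    rw [h2] at key
    rw [← key, ← mul_apply_eq_comp, ← Submonoid.coe_mul, inv_mul_cancel]
    rfl

lemma regularHom_monomial_delta (α : Fin n → ℤ) :
    regularHom θ (monomial θ α) (delta 0) = delta α := by
  have h1 : regularHom θ (monomial θ α) =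
      ((List.ofFn fun j => regularU θ j ^ α j).prod : unitary (Ell2 n →L[ℂ] Ell2 n)) := by
    let G : unitary (QuantumTorus θ) →* unitary (Ell2 n →L[ℂ] Ell2 n) :=
      { toFun := fun v => ⟨regularHom θ (v : QuantumTorus θ), Unitary.map_mem (regularHom θ) v.2⟩
        map_one' := Subtype.ext (map_one (regularHom θ))
        map_mul' := fun v w => Subtype.ext (map_mul (regularHom θ) (v : QuantumTorus θ) w) }
    have h0 : ∀ j, G (U θ j) = regularU θ j := fun j => rfl
    have : G (List.ofFn fun j => U θ j ^ α j).prod =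
        (List.ofFn fun j => regularU θ j ^ α j).prod := by
      rw [map_list_prod, List.map_ofFn]
      congr 2
      ext1 j
      rw [Function.comp_apply, map_zpow, h0]
    rw [← this]
    rfl
  rw [h1]
  have key : ∀ m i : ℕ, i + m = n →
      ((((List.ofFn fun j => regularU θ j ^ α j).drop i).prod :
        unitary (Ell2 n →L[ℂ] Ell2 n)) : Ell2 n →L[ℂ] Ell2 n) (delta 0) =
      delta (fun j => if i ≤ j then α j else 0) := by
    intro m
    induction m with
    | zero =>
      intro i hi
      rw [List.drop_of_length_le (by simp; omega)]
      have : (fun j : Fin n => if i ≤ j then α j else 0) = 0 := by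
        ext j
        simp
        omega
      rw [this]
      simp
    | succ m ih =>
      intro i hi
      have hin : i < n := by omega
      rw [List.drop_eq_getElem_cons (by simpa using hin), List.prod_cons, Submonoid.coe_mul,
        mul_apply_eq_comp, ih (i + 1) (by omega), List.getElem_ofFn, regularU_zpow_delta]
      · congr 1
        ext j
        by_cases hj : j = ⟨i, hin⟩
        · subst hj
          simp
        · have : (j : ℕ) ≠ i := fun h => hj (Fin.ext h)
          simp only [Pi.add_apply, Pi.single_apply, hj, if_false, add_zero]
          congr 1
          exact propext ⟨fun _ => by omega, fun _ => by omega⟩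
      · intro k hk
        have : (k : ℕ) < i := hk
        simp
        omega
  simpa using key n 0 (by simp)

lemma inner_delta (α β : Fin n → ℤ) :
    ⟪(delta α : Ell2 n), delta β⟫_ℂ = if α = β then 1 else 0 := by
  rw [delta, delta, lp.inner_single_left]
  simp [lp.single_apply, Pi.single_apply]

/-- `τ (U ^ α) = 1` if `α = 0` and `0` otherwise. -/
lemma trace_monomial (α : Fin n → ℤ) : trace θ (monomial θ α) = if α = 0 then 1 else 0 := by
  rw [trace_apply, regularHom_monomial_delta, inner_delta]
  simp [eq_comm]

lemma linearIndependent_monomial : LinearIndependent ℂ (monomial θ) := by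
  have hδ : LinearIndependent ℂ (delta : (Fin n → ℤ) → Ell2 n) :=
    Orthonormal.linearIndependent (𝕜 := ℂ) (orthonormal_iff_ite.2 inner_delta)
  let F : QuantumTorus θ →ₗ[ℂ] Ell2 n :=
    { toFun := fun a => regularHom θ a (delta 0)
      map_add' := fun a b => by
        rw [map_add]
        rfl
      map_smul' := fun c a => by
        rw [map_smul]
        rfl }
  refine LinearIndependent.of_comp F ?_
  have : F ∘ monomial θ = delta := funext fun α => regularHom_monomial_delta θ α
  rw [this]
  exact hδ

/-! ### Polynomials -/

/-- Polynomials: finite linear combinations of the `U ^ α`, `α ∈ ℤⁿ`. -/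
def Poly : Submodule ℂ (QuantumTorus θ) := Submodule.span ℂ (Set.range (monomial θ))

/-- The basis `(U ^ α)` of the space of polynomials. -/
def polyBasis : Module.Basis (Fin n → ℤ) ℂ (Poly θ) :=
  Module.Basis.span (linearIndependent_monomial θ)

/-- `|α| = ∑ j, |α j|`. -/
def degree (α : Fin n → ℤ) : ℕ := ∑ j, (α j).natAbs

/-- `L (∑ x_α U ^ α) = ∑ |α| x_α U ^ α`. -/
def generator : Poly θ →ₗ[ℂ] Poly θ :=
  (polyBasis θ).constr ℂ fun α => (degree α : ℂ) • polyBasis θ α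

/-- `P_t (∑ x_α U ^ α) = ∑ e ^ (-t |α|) x_α U ^ α`. -/
def semigroup (t : ℝ) : Poly θ →ₗ[ℂ] Poly θ :=
  (polyBasis θ).constr ℂ fun α => (Real.exp (-t * degree α) : ℂ) • polyBasis θ α

/-- Holomorphic polynomials: the span of the `U ^ α` with `α ∈ ℕⁿ`. -/
def holomorphic : Submodule ℂ (QuantumTorus θ) :=
  Submodule.span ℂ {x | ∃ α : Fin n → ℤ, (∀ j, 0 ≤ α j) ∧ x = monomial θ α}

/-- The tail space: the span of the `U ^ α` with `|α| ≥ d`. -/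
def tailSpace (d : ℕ) : Submodule ℂ (QuantumTorus θ) :=
  Submodule.span ℂ {x | ∃ α : Fin n → ℤ, d ≤ degree α ∧ x = monomial θ α}

/-- The low-degree space: the span of the `U ^ α` with `|α| ≤ d`. -/
def lowSpace (d : ℕ) : Submodule ℂ (QuantumTorus θ) :=
  Submodule.span ℂ {x | ∃ α : Fin n → ℤ, degree α ≤ d ∧ x = monomial θ α}

/-! ### Noncommutative `L_p`-norms -/

section Lp

variable {H : Type*} [NormedAddCommGroup H] [InnerProductSpace ℂ H] [CompleteSpace H]

/-- The von Neumann algebra generated by a unital ⋆-algebra of operators (its bicommutant). -/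
def generatedVN (S : StarSubalgebra ℂ (H →L[ℂ] H)) : VonNeumannAlgebra H where
  toStarSubalgebra := StarSubalgebra.centralizer ℂ
    (StarSubalgebra.centralizer ℂ (S : Set (H →L[ℂ] H)) : Set (H →L[ℂ] H))
  centralizer_centralizer' := by
    simp

lemma le_generatedVN (S : StarSubalgebra ℂ (H →L[ℂ] H)) {x : H →L[ℂ] H} (hx : x ∈ S) :
    x ∈ generatedVN S := by
  change x ∈ (StarSubalgebra.centralizer ℂ
    (StarSubalgebra.centralizer ℂ (S : Set (H →L[ℂ] H)) : Set (H →L[ℂ] H)))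
  rw [StarSubalgebra.mem_centralizer_iff]
  intro g hg
  have hg' := star_mem hg
  rw [SetLike.mem_coe, StarSubalgebra.mem_centralizer_iff] at hg
  rw [StarSubalgebra.mem_centralizer_iff] at hg'
  exact ⟨((hg x hx).1).symm, ((hg' x hx).1).symm⟩

/-- `(x⋆ x) ^ r` for `x` in a von Neumann algebra, by the continuous functional calculus. -/
def starMulSelfPow (M : VonNeumannAlgebra H) (x : M) (r : ℝ) : M :=
  ⟨cfc (fun s : ℝ => s ^ r) (star (x : H →L[ℂ] H) * (x : H →L[ℂ] H)), by
    have hx : star (x : H →L[ℂ] H) * (x : H →L[ℂ] H) ∈ M := mul_mem (star_mem x.2) x.2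
    rw [← SetLike.mem_coe, ← M.centralizer_centralizer]
    intro y hy
    have hc : Commute (star (x : H →L[ℂ] H) * (x : H →L[ℂ] H)) y := hy _ hx
    exact (hc.cfc_real _).eq.symm⟩

/-- The noncommutative `L_p`-norm on a von Neumann algebra `M` with respect to `τ`:
`‖x‖_p = τ ((x⋆ x) ^ (p / 2)) ^ (1 / p)` for `p < ∞`, and the operator norm for `p = ∞`. -/
def ncLpNorm (M : VonNeumannAlgebra H) (τ : M → ℂ) (p : ℝ≥0∞) (x : M) : ℝ :=
  if p = ∞ then ‖(x : H →L[ℂ] H)‖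
  else (τ (starMulSelfPow M x (p.toReal / 2))).re ^ (1 / p.toReal)

end Lp

/-- The von Neumann algebra `𝕋_θ` generated by the quantum torus in the GNS representation of its
canonical trace. -/
def torusVN : VonNeumannAlgebra (trace θ).GNS := generatedVN (trace θ).gnsStarAlgHom.range

/-- The canonical map from the quantum torus to `𝕋_θ`. -/
def toVN (x : QuantumTorus θ) : torusVN θ :=
  ⟨(trace θ).gnsStarAlgHom x, le_generatedVN _ ⟨x, rfl⟩⟩

/-- The cyclic vector of the GNS representation: the class of `1`. -/
def cyclicVector : (trace θ).GNS := ((trace θ).toPreGNS 1 : (trace θ).PreGNS)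

/-- The canonical trace on `𝕋_θ`: the vector state of the cyclic vector. -/
def vnTrace (x : torusVN θ) : ℂ :=
  ⟪cyclicVector θ, (x : (trace θ).GNS →L[ℂ] (trace θ).GNS) (cyclicVector θ)⟫_ℂ

/-- The norm of `L_p(𝕋_θ)` on the quantum torus. -/
def torusLpNorm (p : ℝ≥0∞) (x : QuantumTorus θ) : ℝ :=
  ncLpNorm (torusVN θ) (vnTrace θ) p (toVN θ x)

end QTorus

end

/-! The gauge action `U^α ↦ z^(∑ α_j) U^α`, for `z` on the unit circle, preserves every `L_p`-norm.
On holomorphic polynomials `∑ α_j = |α|`, so `L` and `P_t` become one-variable Fourier multipliers,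
and a multiplier that is a positive combination of characters has norm at most its total mass. By
the Fejér kernel, `m ↦ D - m` on `0 ≤ m ≤ D` is such a combination, of mass `D`
(`exists_fejer_weights`, `multiplier_sub_le`).

For degrees in `[0, d]`, the choice `m = d - |α|`, `D = d` gives `‖L x‖ ≤ d ‖x‖`. Exponentiating, `x
= e^{tL} P_t x` has norm at most `e^{td} ‖P_t x‖`. For degrees in `[d, B]`, the choice `m = |α| -
d`, `D = B - d` gives `‖(B - L) x‖ ≤ (B - d) ‖x‖`. Then `B x = L x + (B - L) x` yields `‖L x‖ ≥ d
‖x‖`, and `P_t = e^{-tB} e^{t(B - L)}` yields the factor `e^{-td}`. The auxiliary bound `B` on the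
degrees cancels in both estimates. A monomial of degree `d` gives equality.

These arguments use only a gauge-invariant seminorm equal to one on monomials (`IsGaugeInvariant`).
For finite `p` the triangle inequality comes from trace convexity: Klein's inequality for
self-adjoint elements, then the dilation `[[0, x], [x⋆, 0]]` for general ones (`powerTrace_convex`,
`lpSeminorm`). Gauge invariance holds because the action is implemented on `ℓ²(ℤⁿ)` by unitaries
fixing `δ_0`, which preserves operator norms and all moments of `x⋆ x` (`torusLpNorm_eq_of_conj`).
-/

noncomputable section

/-! ### Klein's inequality and convexity of trace functions. -/

namespace TraceNorm

open Filter Topology unitInterval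

variable {B : Type*} [CStarAlgebra B]

/-- A positive tracial functional on a C⋆-algebra. -/
structure IsPositiveTrace (φ : B →L[ℝ] ℝ) : Prop where
  nonneg : ∀ x, 0 ≤ φ (star x * x)
  comm : ∀ x y, φ (x * y) = φ (y * x)

lemma cfc_eq_sq_sqrt (h : ℝ → ℝ) (hc : Continuous h) (h0 : ∀ s, 0 ≤ h s) (a : B) :
    cfc h a = cfc (fun s => √(h s)) a * cfc (fun s => √(h s)) a := by
  rw [← cfc_mul (fun s => √(h s)) (fun s => √(h s)) a (by fun_prop) (by fun_prop)]
  exact congrArg (cfc · a) (funext fun s => (Real.mul_self_sqrt (h0 s)).symm)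

namespace IsPositiveTrace

variable {φ : B →L[ℝ] ℝ}

/-- With square roots `S`, `T` of the two factors, traciality gives `φ(S² T²) = φ((ST)⋆ (ST))`. This
is the substitute for commutativity of `a` and `c`. -/
lemma cfc_mul_cfc_nonneg (hφ : IsPositiveTrace φ) {h k : ℝ → ℝ} (hc : Continuous h)
    (kc : Continuous k) (h0 : ∀ s, 0 ≤ h s) (k0 : ∀ s, 0 ≤ k s) (a c : B) :
    0 ≤ φ (cfc h a * cfc k c) := by
  rw [cfc_eq_sq_sqrt h hc h0, cfc_eq_sq_sqrt k kc k0]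
  have hS : IsSelfAdjoint (cfc (fun s => √(h s)) a) := cfc_predicate _ _
  have hT : IsSelfAdjoint (cfc (fun s => √(k s)) c) := cfc_predicate _ _
  generalize cfc (fun s => √(h s)) a = S at *
  generalize cfc (fun s => √(k s)) c = T at *
  have : φ (S * S * (T * T)) = φ (star (S * T) * (S * T)) := by
    rw [star_mul, hS.star_eq, hT.star_eq, ← mul_assoc (S * S), hφ.comm]
    simp only [mul_assoc]
  rw [this]
  exact hφ.nonneg _

lemma cfc_nonneg (hφ : IsPositiveTrace φ) {h : ℝ → ℝ} (hc : Continuous h)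
    (h0 : ∀ s, 0 ≤ h s) {a : B} (ha : IsSelfAdjoint a) : 0 ≤ φ (cfc h a) := by
  have := hφ.cfc_mul_cfc_nonneg hc (k := fun _ => 1) (by fun_prop) h0 (by simp) a a
  rwa [cfc_const_one ℝ a, mul_one] at this

lemma one_nonneg (hφ : IsPositiveTrace φ) : 0 ≤ φ 1 := by
  simpa using hφ.nonneg 1

end IsPositiveTrace

/-- The functional calculus of a self-adjoint element with spectrum in `[-K, K]`, as a linear map
on the continuous functions on the unit interval. -/
def intervalCalculus (K : ℝ) (a : B) : C(I, ℝ) →ₗ[ℝ] B where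
  toFun v := cfc (fun t => v (Set.projIcc 0 1 zero_le_one ((t + K) / (2 * K)))) a
  map_add' v w := by
    simp only [ContinuousMap.add_apply]
    exact cfc_add _ _ _
  map_smul' c v := by
    simp only [ContinuousMap.smul_apply]
    exact cfc_smul _ _ _

lemma intervalCalculus_apply (K : ℝ) (a : B) (v : C(I, ℝ)) :
    intervalCalculus K a v =
      cfc (fun t => v (Set.projIcc 0 1 zero_le_one ((t + K) / (2 * K)))) a := rfl

lemma continuous_intervalCalculus (K : ℝ) (a : B) : Continuous (intervalCalculus K a) :=
  AddMonoidHomClass.continuous_of_bound (intervalCalculus K a) 1 fun v => by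
    rw [one_mul, intervalCalculus_apply]
    exact norm_cfc_le (norm_nonneg v) fun t _ => v.norm_coe_le_norm _

/-- The affine change of variable maps the spectrum into the unit interval, so `projIcc` does not
truncate there. -/
lemma intervalCalculus_comp {K : ℝ} {a : B} (hK : ‖a‖ ≤ K) (hK0 : 0 < K)
    {u : ℝ → ℝ} (hu : Continuous u) :
    intervalCalculus K a ⟨fun s : I => u (2 * K * s - K), by fun_prop⟩ = cfc u a := by
  rw [intervalCalculus_apply]
  refine cfc_congr fun t ht => ?_
  have h1 : |t| ≤ K := by
    have := spectrum.norm_le_norm_mul_of_mem ht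
    rcases subsingleton_or_nontrivial B with hB | hB
    · simp [spectrum.of_subsingleton] at ht
    · simpa using this.trans (by simpa using hK)
  have h2 := abs_le.1 h1
  have h3 : (t + K) / (2 * K) ∈ Set.Icc (0 : ℝ) 1 :=
    ⟨div_nonneg (by linarith) (by linarith), by rw [div_le_one (by linarith)]; linarith⟩
  simp only [ContinuousMap.coe_mk, Set.projIcc_of_mem zero_le_one h3]
  congr 1
  field_simp
  ring

/-- The Bernstein polynomials at `a` act as an approximate spectral resolution: positive elements
attached to nodes in `[-K, K]`, usable where spectral projections are not in the algebra. -/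
lemma tendsto_bernstein_cfc {K : ℝ} {a : B} (hK : ‖a‖ ≤ K) (hK0 : 0 < K)
    {u : ℝ → ℝ} (hu : Continuous u) :
    Tendsto (fun n => ∑ k : Fin (n + 1), u (2 * K * (bernstein.z k : I) - K) •
      intervalCalculus K a (bernstein n k)) atTop (𝓝 (cfc u a)) := by
  have h := ((continuous_intervalCalculus K a).tendsto _).comp
    (bernsteinApproximation_uniform ⟨fun s : I => u (2 * K * s - K), by fun_prop⟩)
  rw [intervalCalculus_comp hK hK0 hu] at h
  refine h.congr fun n => ?_
  have : bernsteinApproximation n (⟨fun s : I => u (2 * K * s - K), by fun_prop⟩ : C(I, ℝ)) =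
      ∑ k : Fin (n + 1), u (2 * K * (bernstein.z k : I) - K) • bernstein n k := by
    ext s
    simp [bernsteinApproximation.apply, mul_comm]
  rw [Function.comp_apply, this, map_sum]
  simp

variable {φ : B →L[ℝ] ℝ}

/-- **Klein's inequality**, up to an error `ε`. -/
lemma IsPositiveTrace.klein (hφ : IsPositiveTrace φ) {f g : ℝ → ℝ} (hf : Continuous f)
    (hg : Continuous g) {ε : ℝ} (hfg : ∀ s r, f r + (s - r) * g r ≤ f s + ε)
    {a c : B} (ha : IsSelfAdjoint a) (hc : IsSelfAdjoint c) :
    φ (cfc f c) + φ ((a - c) * cfc g c) ≤ φ (cfc f a) + ε * φ 1 := by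
  have hK : ‖a‖ ≤ ‖a‖ + 1 := by linarith
  -- The extra one keeps the interval nondegenerate when `a = 0`.
  have hK0 : 0 < ‖a‖ + 1 := by positivity
  set K := ‖a‖ + 1
  have h1 := tendsto_bernstein_cfc hK hK0 (u := fun _ => 1) continuous_const
  have h2 := tendsto_bernstein_cfc hK hK0 (u := fun s => s) continuous_id
  have h3 := tendsto_bernstein_cfc hK hK0 hf
  rw [cfc_const_one ℝ a] at h1
  rw [cfc_id' ℝ a] at h2
  have key : ∀ s, cfc (fun r => f s + ε - f r - (s - r) * g r) c =
      (f s + ε) • 1 - cfc f c - s • cfc g c + c * cfc g c := by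
    intro s
    have e : (fun r => f s + ε - f r - (s - r) * g r) =
        fun r => ((f s + ε) - f r - s * g r) + r * g r := by
      ext r
      ring
    rw [e, cfc_add c _ _ (by fun_prop) (by fun_prop), cfc_sub _ _ c (by fun_prop) (by fun_prop),
      cfc_sub _ _ c (by fun_prop) (by fun_prop), cfc_const_mul _ _ c (by fun_prop),
      cfc_const _ c, cfc_mul _ _ c (by fun_prop) (by fun_prop), cfc_id' ℝ c,
      Algebra.algebraMap_eq_smul_one]
  -- The scalar inequality with `s` frozen at each node is applied to `c` and paired with the
  -- Bernstein element of `a` at that node. In the limit, `∑ f(s_k) b_k(a)`, `∑ s_k b_k(a)` and `∑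
  -- b_k(a)` become `f(a)`, `a` and `1`.
  have hpos : ∀ n, 0 ≤ ∑ k : Fin (n + 1), φ (intervalCalculus K a (bernstein n k) *
      ((f (2 * K * (bernstein.z k : I) - K) + ε) • 1 - cfc f c -
        (2 * K * (bernstein.z k : I) - K) • cfc g c + c * cfc g c)) := by
    refine fun n => Finset.sum_nonneg fun k _ => ?_
    rw [← key]
    refine hφ.cfc_mul_cfc_nonneg (by fun_prop) (by fun_prop) (fun _ => bernstein_nonneg)
      (fun r => ?_) _ _
    have := hfg (2 * K * (bernstein.z k : I) - K) r
    linarith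
  have lim : Tendsto (fun n => φ ((∑ k : Fin (n + 1), f (2 * K * (bernstein.z k : I) - K) •
      intervalCalculus K a (bernstein n k)) +
      (∑ k : Fin (n + 1), (1 : ℝ) • intervalCalculus K a (bernstein n k)) *
        (ε • 1 - cfc f c + c * cfc g c) -
      (∑ k : Fin (n + 1), (2 * K * (bernstein.z k : I) - K) •
        intervalCalculus K a (bernstein n k)) * cfc g c)) atTop
      (𝓝 (φ (cfc f a + 1 * (ε • 1 - cfc f c + c * cfc g c) - a * cfc g c))) :=
    (φ.continuous.tendsto _).comp ((h3.add (h1.mul_const _)).sub (h2.mul_const _))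
  have : 0 ≤ φ (cfc f a + 1 * (ε • 1 - cfc f c + c * cfc g c) - a * cfc g c) := by
    refine ge_of_tendsto' lim fun n => (hpos n).trans_eq ?_
    rw [← map_sum]
    congr 1
    simp only [Finset.sum_mul, ← Finset.sum_add_distrib, ← Finset.sum_sub_distrib]
    refine Finset.sum_congr rfl fun k _ => ?_
    simp only [mul_add, mul_sub, add_smul, one_smul, mul_smul_comm, smul_mul_assoc, mul_one]
    abel
  simp only [one_mul, map_add, map_sub, map_smul, smul_eq_mul, sub_mul] at this ⊢
  linarith

/-- Klein's inequality is used at `(a, c)` and `(b, c)` with `c = t a + u b`. The first-order terms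
cancel in the weighted sum since `t (a - c) + u (b - c) = 0`. -/
lemma IsPositiveTrace.convex_cfc (hφ : IsPositiveTrace φ) {f : ℝ → ℝ} (hf : Continuous f)
    (hfg : ∀ ε > 0, ∃ g : ℝ → ℝ, Continuous g ∧ ∀ s r, f r + (s - r) * g r ≤ f s + ε)
    {a b : B} (ha : IsSelfAdjoint a) (hb : IsSelfAdjoint b) {t u : ℝ} (ht : 0 ≤ t) (hu : 0 ≤ u)
    (htu : t + u = 1) :
    φ (cfc f (t • a + u • b)) ≤ t * φ (cfc f a) + u * φ (cfc f b) := by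
  refine le_of_forall_pos_le_add fun δ hδ => ?_
  have h1 := hφ.one_nonneg
  obtain ⟨g, hg, H⟩ := hfg (δ / (φ 1 + 1)) (by positivity)
  have hab : IsSelfAdjoint (t • a + u • b) := (IsSelfAdjoint.smul (.all t) ha).add (.smul (.all u) hb)
  have ka := hφ.klein hf hg H ha hab
  have kb := hφ.klein hf hg H hb hab
  set c := t • a + u • b
  have hz : t * φ ((a - c) * cfc g c) + u * φ ((b - c) * cfc g c) = 0 := by
    have : t • ((a - c) * cfc g c) + u • ((b - c) * cfc g c) = 0 := by
      have : t • (a - c) + u • (b - c) = 0 := by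
        have e : t • (a - c) + u • (b - c) = c - (t + u) • c := by
          simp only [c]
          module
        rw [e, htu, one_smul, sub_self]
      rw [← smul_mul_assoc, ← smul_mul_assoc, ← add_mul, this, zero_mul]
    simpa using congrArg φ this
  have hd : δ / (φ 1 + 1) * φ 1 ≤ δ := by
    rw [div_mul_eq_mul_div, div_le_iff₀ (by positivity)]
    nlinarith
  have e1 := mul_le_mul_of_nonneg_left ka ht
  have e2 := mul_le_mul_of_nonneg_left kb hu
  have e3 : u = 1 - t := by linarith
  subst e3
  nlinarith

lemma exists_approx_subgradient_abs_rpow {p : ℝ} (hp : 1 ≤ p) (ε : ℝ) (hε : 0 < ε) :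
    ∃ g : ℝ → ℝ, Continuous g ∧ ∀ s r, |r| ^ p + (s - r) * g r ≤ |s| ^ p + ε := by
  rcases hp.eq_or_lt with rfl | hp
  -- For `p = 1` the subgradient is the discontinuous sign function; a ramp of width `ε` costs an
  -- error of at most `ε`.
  · refine ⟨fun r => max (-1) (min 1 (r / ε)), by fun_prop, fun s r => ?_⟩
    simp only [Real.rpow_one]
    have hle : max (-1) (min 1 (r / ε)) ≤ 1 := max_le (by norm_num) (min_le_left _ _)
    have hge : -1 ≤ max (-1) (min 1 (r / ε)) := le_max_left _ _
    have h1 : s * max (-1) (min 1 (r / ε)) ≤ |s| := by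
      refine (le_abs_self _).trans ?_
      rw [abs_mul]
      exact mul_le_of_le_one_right (abs_nonneg s) (abs_le.2 ⟨hge, hle⟩)
    have h2 : |r| ≤ r * max (-1) (min 1 (r / ε)) + ε := by
      rcases le_total 0 r with h | h
      · rw [abs_of_nonneg h]
        rcases le_total r ε with h' | h'
        · have : 0 ≤ max (-1) (min 1 (r / ε)) := le_max_of_le_right (le_min zero_le_one (by positivity))
          nlinarith
        · have : 1 ≤ max (-1) (min 1 (r / ε)) :=
            le_max_of_le_right (le_min le_rfl ((one_le_div hε).2 h'))
          nlinarith
      · rw [abs_of_nonpos h]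
        rcases le_total (-r) ε with h' | h'
        · have : max (-1) (min 1 (r / ε)) ≤ 0 :=
            max_le (by norm_num) ((min_le_right _ _).trans (div_nonpos_of_nonpos_of_nonneg h hε.le))
          nlinarith
        · have : max (-1) (min 1 (r / ε)) ≤ -1 :=
            max_le le_rfl ((min_le_right _ _).trans ((div_le_iff₀ hε).2 (by linarith)))
          nlinarith
    linarith
  · have hp0 : 0 < p := by linarith
    -- For `p > 1` the derivative itself is continuous, and Young's inequality gives the bound
    -- without error.
    refine ⟨fun r => p * (r * |r| ^ (p - 2)), ?_, fun s r => ?_⟩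
    · refine continuous_const.mul ?_
      rw [continuous_iff_continuousAt]
      intro r
      rcases eq_or_ne r 0 with rfl | hr
      · rw [ContinuousAt, zero_mul]
        refine squeeze_zero_norm' (a := fun r : ℝ => |r| ^ (p - 1)) (.of_forall fun r => ?_) ?_
        · rcases eq_or_ne r 0 with rfl | hr
          · simp [Real.rpow_nonneg]
          · rw [norm_mul, Real.norm_eq_abs, Real.norm_of_nonneg (by positivity),
              ← Real.rpow_one_add' (abs_nonneg r) (by linarith)]
            exact le_of_eq (by ring_nf)
        · have : Continuous fun r : ℝ => |r| ^ (p - 1) :=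
            continuous_abs.rpow_const fun _ => .inr (by linarith)
          simpa [Real.zero_rpow (by linarith : p - 1 ≠ 0)] using this.tendsto 0
      · exact continuousAt_id.mul (continuousAt_id.abs.rpow_const (.inl (abs_ne_zero.2 hr)))
    · have hrr : r * (p * (r * |r| ^ (p - 2))) = p * |r| ^ p := by
        rcases eq_or_ne r 0 with rfl | hr
        · simp [Real.zero_rpow hp0.ne']
        · have : |r| ^ p = r * r * |r| ^ (p - 2) := by
            rw [← abs_mul_abs_self, ← pow_two, ← Real.rpow_natCast, ← Real.rpow_add (abs_pos.2 hr)]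
            norm_num
          rw [this]
          ring
      have hpq : p.HolderConjugate (p / (p - 1)) := Real.HolderConjugate.conjExponent hp
      have hy := Real.young_inequality_of_nonneg (abs_nonneg s)
        (Real.rpow_nonneg (abs_nonneg r) (p - 1)) hpq
      have hq : (|r| ^ (p - 1)) ^ (p / (p - 1)) = |r| ^ p := by
        rw [← Real.rpow_mul (abs_nonneg r)]
        congr 1
        field_simp [show p - 1 ≠ 0 by linarith]
      rw [hq] at hy
      have hs : s * (r * |r| ^ (p - 2)) ≤ |s| * |r| ^ (p - 1) := by
        rcases eq_or_ne r 0 with rfl | hr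
        · simp only [zero_mul, mul_zero]
          positivity
        · have : |r| ^ (p - 1) = |r| * |r| ^ (p - 2) := by
            rw [← Real.rpow_one_add' (abs_nonneg r) (by linarith)]
            ring_nf
          rw [this]
          refine (le_abs_self _).trans (le_of_eq ?_)
          rw [abs_mul, abs_mul, abs_of_nonneg (Real.rpow_nonneg (abs_nonneg r) _)]
      have hy' : p * (|s| * |r| ^ (p - 1)) ≤ |s| ^ p + (p - 1) * |r| ^ p := by
        have e : p * (|s| ^ p / p + |r| ^ p / (p / (p - 1))) = |s| ^ p + (p - 1) * |r| ^ p := by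
          field_simp [show p - 1 ≠ 0 by linarith]
        rw [← e]
        exact mul_le_mul_of_nonneg_left hy hp0.le
      have := mul_le_mul_of_nonneg_left hs hp0.le
      rw [sub_mul, hrr]
      nlinarith

end TraceNorm

/-! ### Comparison of functionals through moments. -/

namespace TraceNorm

open Filter Topology

section Moments

variable {B C : Type*} [CStarAlgebra B] [CStarAlgebra C]

lemma abs_apply_aeval_sub_apply_cfc_le (φ : B →L[ℝ] ℝ) {a : B} (ha : IsSelfAdjoint a) {K : ℝ}
    (haK : ‖a‖ ≤ K) {f : ℝ → ℝ} (hf : Continuous f) {δ : ℝ} (hδ : 0 < δ) {q : Polynomial ℝ}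
    (hq : ∀ t ∈ Set.Icc (-K) K, |q.eval t - f t| < δ) :
    |φ (Polynomial.aeval a q) - φ (cfc f a)| ≤ ‖φ‖ * δ := by
  rw [← map_sub, ← cfc_polynomial q a, ← cfc_sub q.eval f a (by fun_prop) (by fun_prop)]
  refine (φ.le_opNorm _).trans (mul_le_mul_of_nonneg_left ?_ (norm_nonneg _))
  refine norm_cfc_le hδ.le fun t ht => (hq t (abs_le.1 ?_)).le
  have := spectrum.norm_le_norm_mul_of_mem ht
  rcases subsingleton_or_nontrivial B with hB | hB
  · simp [spectrum.of_subsingleton] at ht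
  · exact (by simpa using this : |t| ≤ ‖a‖).trans haK

/-- Two continuous functionals whose moments at `a` and `b` agree also agree on `f(a)` and `f(b)`
for all continuous `f`. -/
lemma apply_cfc_eq_of_moments {φ : B →L[ℝ] ℝ} {ψ : C →L[ℝ] ℝ} {a : B} {b : C}
    (ha : IsSelfAdjoint a) (hb : IsSelfAdjoint b) (h : ∀ k : ℕ, φ (a ^ k) = ψ (b ^ k))
    {f : ℝ → ℝ} (hf : Continuous f) : φ (cfc f a) = ψ (cfc f b) := by
  -- Equal moments give equality on polynomials; Weierstrass approximation on an interval containing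
  -- both spectra does the rest.
  have hpoly : ∀ q : Polynomial ℝ, φ (Polynomial.aeval a q) = ψ (Polynomial.aeval b q) := by
    intro q
    simp only [Polynomial.aeval_eq_sum_range, map_sum, map_smul, h]
  refine eq_of_forall_dist_le fun ε hε => ?_
  rw [Real.dist_eq]
  have hδ : 0 < ε / (‖φ‖ + ‖ψ‖ + 1) := by positivity
  obtain ⟨q, hq⟩ := exists_polynomial_near_of_continuousOn (-max ‖a‖ ‖b‖) (max ‖a‖ ‖b‖) f
    hf.continuousOn _ hδ
  have h1 := abs_apply_aeval_sub_apply_cfc_le φ ha (le_max_left ‖a‖ ‖b‖) hf hδ hq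
  have h2 := abs_apply_aeval_sub_apply_cfc_le ψ hb (le_max_right ‖a‖ ‖b‖) hf hδ hq
  rw [hpoly] at h1
  have h3 : (‖φ‖ + ‖ψ‖) * (ε / (‖φ‖ + ‖ψ‖ + 1)) ≤ ε := by
    rw [mul_div_assoc', div_le_iff₀ (by positivity)]
    nlinarith
  rw [abs_sub_comm] at h1
  calc |φ (cfc f a) - ψ (cfc f b)| ≤ _ := abs_sub_le _ (ψ (Polynomial.aeval b q)) _
    _ ≤ _ := add_le_add h1 h2
    _ ≤ ε := by linarith

lemma IsPositiveTrace.mul_star_pow {φ : B →L[ℝ] ℝ} (hφ : IsPositiveTrace φ) (x : B) (k : ℕ) :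
    φ ((x * star x) ^ k) = φ ((star x * x) ^ k) := by
  cases k with
  | zero => simp
  | succ k =>
    have : (x * star x) ^ (k + 1) = x * ((star x * x) ^ k * star x) := by
      rw [pow_succ']
      have : (star x) * (x * star x) ^ k = (star x * x) ^ k * star x :=
        (show SemiconjBy (star x) (x * star x) (star x * x) by
          simp [SemiconjBy, mul_assoc]).pow_right k
      rw [mul_assoc, this]
    rw [this, hφ.comm, mul_assoc, ← pow_succ]

end Moments

/-- The C⋆-algebra of `2 × 2` matrices over a C⋆-algebra. -/
def TwoByTwo (B : Type*) : Type _ := CStarMatrix (Fin 2) (Fin 2) B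

section TwoByTwo

variable {B : Type*}

/-- The matrix with the given entries. -/
def TwoByTwo.of (X : Matrix (Fin 2) (Fin 2) B) : TwoByTwo B := CStarMatrix.ofMatrix X

/-- The entries of a matrix. -/
def TwoByTwo.entry (X : TwoByTwo B) (i j : Fin 2) : B := CStarMatrix.ofMatrix.symm X i j

lemma TwoByTwo.entry_of (X : Matrix (Fin 2) (Fin 2) B) (i j : Fin 2) :
    (TwoByTwo.of X).entry i j = X i j := rfl

lemma TwoByTwo.ext {X Y : TwoByTwo B} (h : ∀ i j, X.entry i j = Y.entry i j) : X = Y :=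
  CStarMatrix.ext h

variable [CStarAlgebra B] [PartialOrder B] [StarOrderedRing B]

instance : CStarAlgebra (TwoByTwo B) :=
  inferInstanceAs (CStarAlgebra (CStarMatrix (Fin 2) (Fin 2) B))

namespace TwoByTwo

lemma entry_add (X Y : TwoByTwo B) (i j : Fin 2) :
    (X + Y).entry i j = X.entry i j + Y.entry i j := rfl

lemma entry_smul (t : ℝ) (X : TwoByTwo B) (i j : Fin 2) :
    (t • X).entry i j = t • X.entry i j := rfl

lemma entry_star (X : TwoByTwo B) (i j : Fin 2) :
    (star X).entry i j = star (X.entry j i) := rfl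

lemma entry_one (i j : Fin 2) : (1 : TwoByTwo B).entry i j = if i = j then 1 else 0 := rfl

lemma entry_mul (X Y : TwoByTwo B) (i j : Fin 2) :
    (X * Y).entry i j = X.entry i 0 * Y.entry 0 j + X.entry i 1 * Y.entry 1 j :=
  (CStarMatrix.mul_apply (M := (X : CStarMatrix (Fin 2) (Fin 2) B)) (N := Y)).trans
    (Fin.sum_univ_two _)

lemma norm_entry_le (X : TwoByTwo B) (i j : Fin 2) : ‖X.entry i j‖ ≤ ‖X‖ :=
  CStarMatrix.norm_entry_le_norm (M := X)

end TwoByTwo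

end TwoByTwo

/-! ### Self-adjoint dilation and the `L_p`-seminorm of a trace. -/

variable {B : Type*} [CStarAlgebra B] [PartialOrder B] [StarOrderedRing B]

/-- The self-adjoint dilation `[[0, x], [x⋆, 0]]`. -/
def dilation (x : B) : TwoByTwo B := .of !![0, x; star x, 0]

lemma isSelfAdjoint_dilation (x : B) : IsSelfAdjoint (dilation x) :=
  TwoByTwo.ext fun i j => by
    rw [TwoByTwo.entry_star]
    fin_cases i <;> fin_cases j <;> simp [dilation, TwoByTwo.entry_of]

lemma dilation_add (x y : B) : dilation (x + y) = dilation x + dilation y :=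
  TwoByTwo.ext fun i j => by
    rw [TwoByTwo.entry_add]
    fin_cases i <;> fin_cases j <;> simp [dilation, TwoByTwo.entry_of]

lemma dilation_smul (t : ℝ) (x : B) : dilation (t • x) = t • dilation x :=
  TwoByTwo.ext fun i j => by
    rw [TwoByTwo.entry_smul]
    fin_cases i <;> fin_cases j <;> simp [dilation, TwoByTwo.entry_of]

lemma dilation_sq_pow (x : B) (k : ℕ) : (dilation x ^ 2) ^ k =
    .of !![(x * star x) ^ k, 0; 0, (star x * x) ^ k] := by
  induction k with
  | zero =>
    refine TwoByTwo.ext fun i j => ?_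
    rw [pow_zero, TwoByTwo.entry_one]
    fin_cases i <;> fin_cases j <;> simp [TwoByTwo.entry_of]
  | succ k ih =>
    rw [pow_succ, ih, pow_two]
    refine TwoByTwo.ext fun i j => ?_
    fin_cases i <;> fin_cases j <;>
      simp [dilation, TwoByTwo.entry_mul, TwoByTwo.entry_of, pow_succ]

/-- The functional `φ ⊗ Tr` on `2 × 2` matrices. -/
def matrixTrace (φ : B →L[ℝ] ℝ) : TwoByTwo B →L[ℝ] ℝ :=
  LinearMap.mkContinuous
    { toFun := fun X => φ (X.entry 0 0) + φ (X.entry 1 1)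
      map_add' := fun X Y => by
        simp only [TwoByTwo.entry_add, map_add]
        ring
      map_smul' := fun t X => by
        simp only [TwoByTwo.entry_smul, map_smul, smul_eq_mul, RingHom.id_apply]
        ring } (2 * ‖φ‖) fun X => by
    have h (i : Fin 2) : ‖φ (X.entry i i)‖ ≤ ‖φ‖ * ‖X‖ := (φ.le_opNorm _).trans
      (mul_le_mul_of_nonneg_left (X.norm_entry_le i i) (norm_nonneg _))
    refine (norm_add_le _ _).trans ?_
    linarith [h 0, h 1]

lemma matrixTrace_apply (φ : B →L[ℝ] ℝ) (X : TwoByTwo B) :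
    matrixTrace φ X = φ (X.entry 0 0) + φ (X.entry 1 1) := rfl

namespace IsPositiveTrace

variable {φ : B →L[ℝ] ℝ}

lemma matrixTrace (hφ : IsPositiveTrace φ) : IsPositiveTrace (matrixTrace φ) where
  nonneg X := by
    simp only [matrixTrace_apply, TwoByTwo.entry_mul, TwoByTwo.entry_star, map_add]
    linarith [hφ.nonneg (X.entry 0 0), hφ.nonneg (X.entry 1 0), hφ.nonneg (X.entry 0 1),
      hφ.nonneg (X.entry 1 1)]
  comm X Y := by
    simp only [matrixTrace_apply, TwoByTwo.entry_mul, map_add]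
    rw [hφ.comm (X.entry 0 0), hφ.comm (X.entry 0 1), hφ.comm (X.entry 1 0),
      hφ.comm (X.entry 1 1)]
    ring

end IsPositiveTrace

/-- `φ (|x| ^ p)`. -/
def powerTrace (φ : B →L[ℝ] ℝ) (p : ℝ) (x : B) : ℝ := φ (cfc (fun s : ℝ => s ^ (p / 2)) (star x * x))

namespace IsPositiveTrace

variable {φ : B →L[ℝ] ℝ} {p : ℝ}

lemma continuous_abs_rpow (hp : 0 ≤ p) : Continuous fun s : ℝ => |s| ^ p :=
  continuous_abs.rpow_const fun _ => .inr hp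

/-- Since `|s|^p = (s²)^(p/2)`, only the square of the dilation matters. It is `diag(x x⋆, x⋆ x)`,
whose two blocks have the same moments under a trace, so its moments are those of `x⋆ x` under `2
φ`. -/
lemma two_mul_powerTrace (hφ : IsPositiveTrace φ) (hp : 0 ≤ p) (x : B) :
    2 * powerTrace φ p x = TraceNorm.matrixTrace φ (cfc (fun s : ℝ => |s| ^ p) (dilation x)) := by
  have hc : Continuous fun s : ℝ => s ^ (p / 2) := Real.continuous_rpow_const (by positivity)
  have e : (fun s : ℝ => |s| ^ p) = fun s : ℝ => (fun u : ℝ => u ^ (p / 2)) (s ^ 2) := by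
    ext s
    dsimp only
    rw [← sq_abs, ← Real.rpow_natCast, ← Real.rpow_mul (abs_nonneg s)]
    congr 1
    push_cast
    ring
  have hsa := isSelfAdjoint_dilation x
  rw [e, cfc_comp_pow _ 2 (dilation x) hc.continuousOn hsa]
  refine (apply_cfc_eq_of_moments (φ := TraceNorm.matrixTrace φ) (ψ := (2 : ℝ) • φ)
    (hsa.pow 2) (.star_mul_self x) (fun k => ?_) hc).symm
  rw [dilation_sq_pow, matrixTrace_apply]
  simp [TwoByTwo.entry_of, hφ.mul_star_pow, two_mul]

lemma powerTrace_nonneg (hφ : IsPositiveTrace φ) (hp : 0 ≤ p) (x : B) : 0 ≤ powerTrace φ p x := by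
  have := hφ.matrixTrace.cfc_nonneg (continuous_abs_rpow hp)
    (fun s => Real.rpow_nonneg (abs_nonneg s) p) (isSelfAdjoint_dilation x)
  rw [← hφ.two_mul_powerTrace hp] at this
  linarith

/-- The dilation is real-linear and self-adjoint, so convexity passes from self-adjoint elements to
arbitrary ones. -/
lemma powerTrace_convex (hφ : IsPositiveTrace φ) (hp : 1 ≤ p) (x y : B) {t u : ℝ} (ht : 0 ≤ t)
    (hu : 0 ≤ u) (htu : t + u = 1) :
    powerTrace φ p (t • x + u • y) ≤ t * powerTrace φ p x + u * powerTrace φ p y := by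
  have hp0 : 0 ≤ p := by linarith
  have := hφ.matrixTrace.convex_cfc (continuous_abs_rpow hp0)
    (exists_approx_subgradient_abs_rpow hp) (isSelfAdjoint_dilation x) (isSelfAdjoint_dilation y)
    ht hu htu
  rw [← dilation_smul, ← dilation_smul, ← dilation_add, ← hφ.two_mul_powerTrace hp0,
    ← hφ.two_mul_powerTrace hp0, ← hφ.two_mul_powerTrace hp0] at this
  linarith

lemma powerTrace_real_smul (hφ : IsPositiveTrace φ) (hp : 0 ≤ p) (t : ℝ) (x : B) :
    powerTrace φ p (t • x) = |t| ^ p * powerTrace φ p x := by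
  have h2 : 2 * powerTrace φ p (t • x) = 2 * (|t| ^ p * powerTrace φ p x) := by
    have hc := continuous_abs_rpow hp
    rw [mul_left_comm, hφ.two_mul_powerTrace hp, hφ.two_mul_powerTrace hp, dilation_smul,
      ← cfc_comp_smul t (fun s : ℝ => |s| ^ p) (dilation x) hc.continuousOn
        (isSelfAdjoint_dilation x)]
    simp only [smul_eq_mul, abs_mul, Real.mul_rpow (abs_nonneg _) (abs_nonneg _)]
    rw [cfc_const_mul _ _ _ hc.continuousOn, map_smul, smul_eq_mul]
  linarith

lemma powerTrace_smul (hφ : IsPositiveTrace φ) (hp : 0 ≤ p) (c : ℂ) (x : B) :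
    powerTrace φ p (c • x) = ‖c‖ ^ p * powerTrace φ p x := by
  have : star (c • x) * (c • x) = star (‖c‖ • x) * (‖c‖ • x) := by
    simp only [star_smul, smul_mul_smul_comm, star_trivial]
    rw [Complex.star_def, Complex.conj_mul', ← Complex.ofReal_pow, Complex.coe_smul, pow_two]
  rw [powerTrace, this, ← powerTrace]
  simpa using hφ.powerTrace_real_smul hp ‖c‖ x

/-- The seminorm `x ↦ φ (|x| ^ p) ^ (1 / p)`. -/
def lpSeminorm (hφ : IsPositiveTrace φ) (p : ℝ) (hp : 1 ≤ p) : Seminorm ℂ B :=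
  Seminorm.of (fun x => powerTrace φ p x ^ (1 / p))
    (fun x y => by
      have hp0 : 0 < p := by linarith
      set N := fun x : B => powerTrace φ p x ^ (1 / p)
      have hN : ∀ x, 0 ≤ N x := fun x => Real.rpow_nonneg (hφ.powerTrace_nonneg hp0.le x) _
      have hNp : ∀ x, powerTrace φ p x = N x ^ p := fun x => by
        rw [← Real.rpow_mul (hφ.powerTrace_nonneg hp0.le x), one_div_mul_cancel hp0.ne',
          Real.rpow_one]
      have hunit : ∀ (x : B) (r : ℝ), 0 < r → N x ≤ r → powerTrace φ p (r⁻¹ • x) ≤ 1 := by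
        intro x r hr hx
        rw [hφ.powerTrace_real_smul hp0.le, hNp, abs_of_pos (by positivity),
          ← Real.mul_rpow (by positivity) (hN x)]
        refine Real.rpow_le_one (mul_nonneg (by positivity) (hN x)) ?_ hp0.le
        rw [inv_mul_le_iff₀ hr]
        linarith
      change N (x + y) ≤ N x + N y
      -- Homogeneity and convexity of the unit ball give the triangle inequality; the slack `δ / 2`
      -- allows normalization of elements of seminorm zero.
      refine le_of_forall_pos_le_add fun δ hδ => ?_
      have hr : 0 < N x + δ / 2 := by linarith [hN x]
      have hs : 0 < N y + δ / 2 := by linarith [hN y]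
      set r := N x + δ / 2
      set s := N y + δ / 2
      have h := hφ.powerTrace_convex hp (r⁻¹ • x) (s⁻¹ • y) (t := r / (r + s)) (u := s / (r + s))
        (by positivity) (by positivity) (by field_simp)
      have e : (r / (r + s)) • r⁻¹ • x + (s / (r + s)) • s⁻¹ • y = (r + s)⁻¹ • (x + y) := by
        rw [smul_smul, smul_smul, smul_add]
        congr 2 <;> field_simp
      rw [e, hφ.powerTrace_real_smul hp0.le, hNp, abs_of_pos (by positivity),
        ← Real.mul_rpow (by positivity) (hN _)] at h
      have h1 : r / (r + s) * powerTrace φ p (r⁻¹ • x) +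
          s / (r + s) * powerTrace φ p (s⁻¹ • y) ≤ 1 := by
        have a1 := mul_le_mul_of_nonneg_left (hunit x r hr (by simp only [r]; linarith))
          (by positivity : 0 ≤ r / (r + s))
        have a2 := mul_le_mul_of_nonneg_left (hunit y s hs (by simp only [s]; linarith))
          (by positivity : 0 ≤ s / (r + s))
        have a3 : r / (r + s) + s / (r + s) = 1 := by field_simp
        linarith
      have h2 : (r + s)⁻¹ * N (x + y) ≤ 1 := by
        by_contra hcon
        exact absurd (h.trans h1) (not_le.2 (Real.one_lt_rpow (not_le.1 hcon) hp0))
      rw [inv_mul_le_iff₀ (by positivity)] at h2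
      simp only [r, s] at h2
      linarith)
    (fun c x => by
      have hp0 : 0 < p := by linarith
      rw [hφ.powerTrace_smul hp0.le, Real.mul_rpow (by positivity)
        (hφ.powerTrace_nonneg hp0.le x), ← Real.rpow_mul (norm_nonneg c), mul_one_div_cancel hp0.ne',
        Real.rpow_one])

end IsPositiveTrace

end TraceNorm

/-! ### The trace, the norms and the gauge action on the quantum torus. -/

namespace QTorus

open Filter Topology TraceNorm

variable {n : ℕ} (θ : SkewMatrix n)

/-! ### Density and the tracial property -/

/-- The inclusion into the product of realizations is a closed embedding, so the image of `S` is
closed and contains the defining closure. This is the density principle behind the commutation and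
trace identities. -/
lemma eq_top_of_isClosed_of_U_mem (S : StarSubalgebra ℂ (QuantumTorus θ))
    (hS : IsClosed (S : Set (QuantumTorus θ))) (hU : ∀ j, (U θ j : QuantumTorus θ) ∈ S)
    (x : QuantumTorus θ) : x ∈ S := by
  let ι : QuantumTorus θ →⋆ₐ[ℂ] BigProduct θ := (generatedSubalgebra θ).subtype
  have hι : IsClosed ((S.map ι : StarSubalgebra ℂ (BigProduct θ)) : Set (BigProduct θ)) := by
    rw [StarSubalgebra.coe_map]
    exact (IsClosed.isClosedEmbedding_subtypeVal
      (inferInstance : IsClosed (generatedSubalgebra θ : Set (BigProduct θ)))).isClosedMap _ hS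
  have hle : generatedSubalgebra θ ≤ S.map ι := by
    refine StarSubalgebra.topologicalClosure_minimal (StarAlgebra.adjoin_le ?_) hι
    rintro _ ⟨j, rfl⟩
    exact ⟨_, hU j, rfl⟩
  obtain ⟨y, hy, hyx⟩ := hle x.2
  have : y = x := Subtype.ext hyx
  exact this ▸ hy

lemma continuous_regularHom : Continuous (regularHom θ) := map_continuous (regularHom θ)

lemma inner_unitary_map_map {H : Type*} [NormedAddCommGroup H] [InnerProductSpace ℂ H]
    [CompleteSpace H] (u : unitary (H →L[ℂ] H)) (x y : H) :
    ⟪(u : H →L[ℂ] H) x, (u : H →L[ℂ] H) y⟫_ℂ = ⟪x, y⟫_ℂ := by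
  rw [← ContinuousLinearMap.adjoint_inner_right, ← ContinuousLinearMap.star_eq_adjoint,
    ← mul_apply_eq_comp, Unitary.coe_star_mul_self]
  rfl

/-- The phase `∑_{k > j} θ k j * α k`. -/
def rightPhase (j : Fin n) (α : Fin n → ℤ) : ℝ :=
  ∑ k ∈ Finset.univ.filter (j < ·), θ.1 k j * α k

lemma rightPhase_sub (j k : Fin n) (β : Fin n → ℤ) :
    rightPhase θ j (β - Pi.single k 1) = rightPhase θ j β - if j < k then θ.1 k j else 0 := by
  simp only [rightPhase, Pi.sub_apply, Pi.single_apply]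
  push_cast
  simp [mul_sub, Finset.sum_sub_distrib, Finset.sum_filter]

/-- The `j`-th twisted right translation on `ℓ²(ℤⁿ)`. -/
def rightU (j : Fin n) : unitary (Ell2 n →L[ℂ] Ell2 n) :=
  Unitary.linearIsometryEquiv.symm (weightedPermEquiv (Equiv.subRight (Pi.single j 1))
    (fun β => Complex.exp (2 * Real.pi * Complex.I * rightPhase θ j (β - Pi.single j 1)))
    fun β => by simp [Complex.norm_exp])

lemma rightU_apply (j : Fin n) (f : Ell2 n) (β : Fin n → ℤ) :
    (rightU θ j : Ell2 n →L[ℂ] Ell2 n) f β =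
      Complex.exp (2 * Real.pi * Complex.I * rightPhase θ j (β - Pi.single j 1)) *
        f (β - Pi.single j 1) := rfl

lemma rightU_delta (j : Fin n) (α : Fin n → ℤ) (h : ∀ k, j < k → α k = 0) :
    (rightU θ j : Ell2 n →L[ℂ] Ell2 n) (delta α) = delta (α + Pi.single j 1) := by
  ext β
  rw [rightU_apply]
  by_cases hβ : β = α + Pi.single j 1
  · subst hβ
    have hp : rightPhase θ j α = 0 :=
      Finset.sum_eq_zero fun k hk => by simp [h k (Finset.mem_filter.1 hk).2]
    simp [delta, hp]
  · have : β - Pi.single j 1 ≠ α := fun h => hβ (by rw [← h]; simp)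
    simp [delta, lp.single_apply, hβ, this]

/-- In either order the extra phase is `θ k j` when `j < k` and zero otherwise. -/
lemma commute_regularU_rightU (j k : Fin n) :
    (regularU θ k : Ell2 n →L[ℂ] Ell2 n) * (rightU θ j : Ell2 n →L[ℂ] Ell2 n) =
      (rightU θ j : Ell2 n →L[ℂ] Ell2 n) * (regularU θ k : Ell2 n →L[ℂ] Ell2 n) := by
  ext f β
  have hsub : β - Pi.single k 1 - Pi.single j 1 = β - Pi.single j 1 - Pi.single k (1 : ℤ) :=
    sub_right_comm _ _ _
  simp only [mul_apply_eq_comp, regularU_apply, rightU_apply, hsub, ← mul_assoc,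
    ← Complex.exp_add]
  congr 2
  simp only [phase_sub, rightPhase_sub]
  push_cast
  ring_nf

lemma commute_regularHom_rightU (j : Fin n) (b : QuantumTorus θ) :
    regularHom θ b * (rightU θ j : Ell2 n →L[ℂ] Ell2 n) =
      (rightU θ j : Ell2 n →L[ℂ] Ell2 n) * regularHom θ b := by
  have hmem := eq_top_of_isClosed_of_U_mem θ ((StarSubalgebra.centralizer ℂ
    {(rightU θ j : Ell2 n →L[ℂ] Ell2 n)}).comap (regularHom θ))
    (by
      rw [StarSubalgebra.coe_comap, StarSubalgebra.coe_centralizer]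
      exact (Set.isClosed_centralizer _).preimage (continuous_regularHom θ))
    (fun k => by
      rw [StarSubalgebra.mem_comap, StarSubalgebra.mem_centralizer_iff]
      rintro _ rfl
      have h1 : (rightU θ j : Ell2 n →L[ℂ] Ell2 n) * regularHom θ (U θ k) =
        regularHom θ (U θ k) * (rightU θ j : Ell2 n →L[ℂ] Ell2 n) :=
        (commute_regularU_rightU θ j k).symm
      refine ⟨h1, ?_⟩
      -- The star-centralizer also requires commutation with the adjoint, which for a unitary is the
      -- inverse.
      have h2 : Commute (rightU θ j) (regularU θ k) := Subtype.ext h1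
      exact congrArg Subtype.val (h2.inv_left).eq) b
  rw [StarSubalgebra.mem_comap, StarSubalgebra.mem_centralizer_iff] at hmem
  exact ((hmem _ rfl).1).symm

/-- Left and right translation agree on `δ_0` and on `δ_{-e_j}`, and right translation commutes with
`b`. Both sides therefore equal `⟪δ_{-e_j}, b δ_0⟫`. -/
lemma trace_U_mul (j : Fin n) (b : QuantumTorus θ) :
    trace θ (U θ j * b) = trace θ (b * U θ j) := by
  have h1 := regularU_delta θ j (-Pi.single j 1) fun k hk => by simp [hk.ne]
  have h2 := rightU_delta θ j (-Pi.single j 1) fun k hk => by simp [hk.ne']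
  have h3 := regularU_delta θ j 0 fun k hk => rfl
  have h4 := rightU_delta θ j 0 fun k hk => rfl
  rw [neg_add_cancel] at h1 h2
  have hR : regularHom θ (U θ j) = (regularU θ j : Ell2 n →L[ℂ] Ell2 n) := rfl
  rw [trace_apply, trace_apply, map_mul, map_mul, mul_apply_eq_comp, mul_apply_eq_comp, hR, h3,
    ← h4, ← mul_apply_eq_comp (regularHom θ b), commute_regularHom_rightU]
  nth_rw 1 [← h1]
  nth_rw 2 [← h2]
  rw [mul_apply_eq_comp, inner_unitary_map_map, inner_unitary_map_map]

lemma continuous_trace : Continuous (trace θ) := by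
  have : Continuous fun a => ⟪(delta 0 : Ell2 n), regularHom θ a (delta 0)⟫_ℂ := by
    have := continuous_regularHom θ
    fun_prop
  exact this

lemma trace_star (a : QuantumTorus θ) : trace θ (star a) = star (trace θ a) := by
  rw [trace_apply, trace_apply, map_star, ContinuousLinearMap.star_eq_adjoint,
    ContinuousLinearMap.adjoint_inner_right]
  exact (inner_conj_symm _ _).symm

lemma trace_mul_comm (a b : QuantumTorus θ) : trace θ (a * b) = trace θ (b * a) := by
  let S : StarSubalgebra ℂ (QuantumTorus θ) :=
    { carrier := {a | ∀ b, trace θ (a * b) = trace θ (b * a)}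
      mul_mem' := fun {x y} hx hy b => by
        rw [mul_assoc, hx, mul_assoc, hy, mul_assoc]
      add_mem' := fun {x y} hx hy b => by
        rw [add_mul, mul_add, map_add, map_add, hx, hy]
      algebraMap_mem' := fun c b => by rw [Algebra.commutes]
      star_mem' := fun {x} hx b => by
        have := hx (star b)
        rw [← star_star b, ← star_mul, ← star_mul, trace_star, trace_star, this] }
  have hS : IsClosed (S : Set (QuantumTorus θ)) := by
    have : (S : Set (QuantumTorus θ)) = ⋂ b, {a | trace θ (a * b) = trace θ (b * a)} := by
      ext
      simp [S]
    rw [this]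
    have := continuous_trace θ
    exact isClosed_iInter fun b => isClosed_eq (by fun_prop) (by fun_prop)
  exact eq_top_of_isClosed_of_U_mem θ S hS (trace_U_mul θ) a b

/-- The real part of the canonical trace, as a continuous real functional. -/
def reTrace : QuantumTorus θ →L[ℝ] ℝ where
  toFun a := (trace θ a).re
  map_add' a b := by rw [map_add, Complex.add_re]
  map_smul' t a := by
    rw [← Complex.coe_smul, map_smul]
    simp
  cont := Complex.continuous_re.comp (continuous_trace θ)

lemma reTrace_apply (a : QuantumTorus θ) : reTrace θ a = (trace θ a).re := rfl

lemma isPositiveTrace_reTrace : IsPositiveTrace (reTrace θ) where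
  nonneg x := (Complex.le_def.1 ((trace θ).map_nonneg (star_mul_self_nonneg x))).1
  comm x y := by rw [reTrace_apply, reTrace_apply, trace_mul_comm]

/-! ### The norms -/

lemma gnsStarAlgHom_apply_coe (x : QuantumTorus θ) (b : (trace θ).PreGNS) :
    (trace θ).gnsStarAlgHom x (b : (trace θ).GNS) = (trace θ).leftMulMapPreGNS x b :=
  PositiveLinearMap.gnsNonUnitalStarAlgHom_apply_coe _

lemma vnTrace_gns (M : torusVN θ) (y : QuantumTorus θ)
    (h : (M : (trace θ).GNS →L[ℂ] (trace θ).GNS) = (trace θ).gnsStarAlgHom y) :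
    vnTrace θ M = trace θ y := by
  rw [vnTrace, h, cyclicVector, gnsStarAlgHom_apply_coe, UniformSpace.Completion.inner_coe,
    PositiveLinearMap.preGNS_inner_def]
  simp

/-- The GNS homomorphism commutes with the continuous functional calculus, so the von Neumann
algebra norm can be computed inside the C⋆-algebra. -/
lemma torusLpNorm_of_ne_top {p : ℝ≥0∞} (hp : p ≠ ∞) (x : QuantumTorus θ) :
    torusLpNorm θ p x = powerTrace (reTrace θ) p.toReal x ^ (1 / p.toReal) := by
  have hc : Continuous fun s : ℝ => s ^ (p.toReal / 2) :=
    Real.continuous_rpow_const (by positivity)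
  rw [torusLpNorm, ncLpNorm, if_neg hp]
  congr 1
  rw [powerTrace, reTrace_apply]
  congr 1
  refine vnTrace_gns θ _ _ ?_
  have := (trace θ).gnsStarAlgHom.map_cfc (fun s : ℝ => s ^ (p.toReal / 2)) (star x * x)
    hc.continuousOn (map_continuous _) (.star_mul_self x) ((IsSelfAdjoint.star_mul_self x).map _)
  rw [this, map_mul, map_star]
  rfl

lemma norm_toPreGNS (a : QuantumTorus θ) :
    ‖(trace θ).toPreGNS a‖ = ‖regularHom θ a (delta 0)‖ := by
  rw [PositiveLinearMap.preGNS_norm_def, PositiveLinearMap.ofPreGNS_toPreGNS, trace_apply,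
    map_mul, map_star, mul_apply_eq_comp, ContinuousLinearMap.star_eq_adjoint,
    ContinuousLinearMap.adjoint_inner_right]
  exact (norm_eq_sqrt_re_inner (𝕜 := ℂ) _).symm

lemma denseRange_regularHom_delta : DenseRange fun a => regularHom θ a (delta 0) := by
  intro f
  have hs := lp.hasSum_single (by norm_num : (2 : ℝ≥0∞) ≠ ∞) f
  refine mem_closure_of_tendsto hs (.of_forall fun s => ?_)
  refine ⟨∑ α ∈ s, f α • monomial θ α, ?_⟩
  simp only [map_sum, map_smul, sum_apply, smul_apply,
    regularHom_monomial_delta]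
  refine Finset.sum_congr rfl fun α _ => ?_
  rw [delta, ← lp.single_smul, smul_eq_mul, mul_one]

/-- The assignment sending the class of `a` to `a δ_0` is isometric with dense range and intertwines
the two representations. -/
lemma norm_gns (x : QuantumTorus θ) : ‖(trace θ).gnsStarAlgHom x‖ = ‖regularHom θ x‖ := by
  have hgns : ∀ a : QuantumTorus θ,
      ‖(trace θ).gnsStarAlgHom x ((trace θ).toPreGNS a : (trace θ).PreGNS)‖ =
        ‖regularHom θ x (regularHom θ a (delta 0))‖ := fun a => by
    rw [gnsStarAlgHom_apply_coe, UniformSpace.Completion.norm_coe,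
      PositiveLinearMap.leftMulMapPreGNS_apply, PositiveLinearMap.ofPreGNS_toPreGNS,
      norm_toPreGNS, map_mul, mul_apply_eq_comp]
  refine le_antisymm (ContinuousLinearMap.opNorm_le_bound _ (norm_nonneg _) fun v => ?_)
    (ContinuousLinearMap.opNorm_le_bound _ (norm_nonneg _) fun f => ?_)
  · induction v using UniformSpace.Completion.induction_on with
    | hp => exact isClosed_le (by fun_prop) (by fun_prop)
    | ih a =>
      have := hgns ((trace θ).ofPreGNS a)
      rw [PositiveLinearMap.toPreGNS_ofPreGNS] at this
      rw [this, UniformSpace.Completion.norm_coe, ← PositiveLinearMap.toPreGNS_ofPreGNS _ a,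
        norm_toPreGNS, PositiveLinearMap.ofPreGNS_toPreGNS]
      exact ContinuousLinearMap.le_opNorm _ _
  · refine (denseRange_regularHom_delta θ).induction_on f (isClosed_le (by fun_prop)
      (by fun_prop)) fun a => ?_
    rw [← hgns, ← norm_toPreGNS, ← UniformSpace.Completion.norm_coe ((trace θ).toPreGNS a)]
    exact ContinuousLinearMap.le_opNorm _ _

lemma torusLpNorm_top (x : QuantumTorus θ) : torusLpNorm θ ∞ x = ‖regularHom θ x‖ := by
  rw [torusLpNorm, ncLpNorm, if_pos rfl]
  exact norm_gns θ x

/-- The norm of `L_p(𝕋_θ)` as a seminorm on the quantum torus. -/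
lemma exists_seminorm_eq_torusLpNorm {p : ℝ≥0∞} (hp : 1 ≤ p) :
    ∃ N : Seminorm ℂ (QuantumTorus θ), ∀ x, N x = torusLpNorm θ p x := by
  by_cases h : p = ∞
  · subst h
    refine ⟨(normSeminorm ℂ (Ell2 n →L[ℂ] Ell2 n)).comp
      (regularHom θ : QuantumTorus θ →ₗ[ℂ] (Ell2 n →L[ℂ] Ell2 n)), fun x => ?_⟩
    rw [torusLpNorm_top]
    rfl
  · have hp' : 1 ≤ p.toReal := by
      simpa using ENNReal.toReal_mono h hp
    exact ⟨(isPositiveTrace_reTrace θ).lpSeminorm p.toReal hp', fun x =>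
      (torusLpNorm_of_ne_top θ h x).symm⟩

/-! ### Gauge invariance -/

/-- Conjugation by `V` preserves the operator norm and, since `V` fixes `δ_0`, the moments of `x⋆
x`. No automorphism of the quantum torus has to be constructed. -/
lemma torusLpNorm_eq_of_conj {x y : QuantumTorus θ} (V : unitary (Ell2 n →L[ℂ] Ell2 n))
    (hV : (V : Ell2 n →L[ℂ] Ell2 n) (delta 0) = delta 0)
    (h : regularHom θ y * (V : Ell2 n →L[ℂ] Ell2 n) =
      (V : Ell2 n →L[ℂ] Ell2 n) * regularHom θ x) (p : ℝ≥0∞) :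
    torusLpNorm θ p y = torusLpNorm θ p x := by
  by_cases hp : p = ∞
  · subst hp
    rw [torusLpNorm_top, torusLpNorm_top, ← CStarRing.norm_mul_coe_unitary _ V, h,
      CStarRing.norm_coe_unitary_mul]
  · rw [torusLpNorm_of_ne_top θ hp, torusLpNorm_of_ne_top θ hp]
    congr 1
    refine apply_cfc_eq_of_moments (.star_mul_self y) (.star_mul_self x) (fun k => ?_)
      (Real.continuous_rpow_const (by positivity))
    have hs : star (regularHom θ y) * (V : Ell2 n →L[ℂ] Ell2 n) =
        (V : Ell2 n →L[ℂ] Ell2 n) * star (regularHom θ x) := by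
      have h1 : regularHom θ x =
          star (V : Ell2 n →L[ℂ] Ell2 n) * (regularHom θ y * (V : Ell2 n →L[ℂ] Ell2 n)) := by
        rw [h, ← mul_assoc, Unitary.coe_star_mul_self, one_mul]
      rw [h1, star_mul, star_mul, star_star, ← mul_assoc, ← mul_assoc,
        Unitary.mul_star_self_of_mem V.2, one_mul]
    have hk : SemiconjBy (V : Ell2 n →L[ℂ] Ell2 n) (regularHom θ ((star x * x) ^ k))
        (regularHom θ ((star y * y) ^ k)) := by
      simp only [map_pow, map_mul, map_star]
      exact SemiconjBy.pow_right (.mul_right hs.symm h.symm) k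
    rw [reTrace_apply, reTrace_apply, trace_apply, trace_apply]
    nth_rw 1 2 [← hV]
    rw [← mul_apply_eq_comp, ← hk.eq, mul_apply_eq_comp, inner_unitary_map_map]

/-- The gauge unitary `δ_α ↦ z ^ (∑ α_j) δ_α`. -/
def gaugeUnitary (n : ℕ) (z : Circle) : unitary (Ell2 n →L[ℂ] Ell2 n) :=
  Unitary.linearIsometryEquiv.symm (weightedPermEquiv (Equiv.refl _)
    (fun β => ((z ^ ∑ j, β j : Circle) : ℂ)) fun _ => Circle.norm_coe _)

lemma gaugeUnitary_apply (z : Circle) (f : Ell2 n) (β : Fin n → ℤ) :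
    (gaugeUnitary n z : Ell2 n →L[ℂ] Ell2 n) f β = ((z ^ ∑ j, β j : Circle) : ℂ) * f β := rfl

lemma gaugeUnitary_delta_zero (z : Circle) :
    (gaugeUnitary n z : Ell2 n →L[ℂ] Ell2 n) (delta 0) = delta 0 := by
  ext β
  rw [gaugeUnitary_apply]
  by_cases h : β = 0
  · simp [h]
  · simp [delta, lp.single_apply, h]

lemma gaugeUnitary_mul_regularU (z : Circle) (j : Fin n) :
    (gaugeUnitary n z : Ell2 n →L[ℂ] Ell2 n) * (regularU θ j : Ell2 n →L[ℂ] Ell2 n) =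
      (z : ℂ) • ((regularU θ j : Ell2 n →L[ℂ] Ell2 n) * (gaugeUnitary n z : Ell2 n →L[ℂ] Ell2 n)) := by
  ext f β
  simp only [mul_apply_eq_comp, smul_apply, lp.coeFn_smul, Pi.smul_apply,
    gaugeUnitary_apply, regularU_apply, smul_eq_mul]
  have : ∑ i, β i = 1 + ∑ i, (β - Pi.single j 1 : Fin n → ℤ) i := by simp
  rw [this, zpow_add, zpow_one, Circle.coe_mul]
  ring

/-- Multiples of the identity by numbers of modulus one. -/
def circleUnitary : Circle →* unitary (Ell2 n →L[ℂ] Ell2 n) where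
  toFun z := ⟨(z : ℂ) • 1, by
    rw [Unitary.mem_iff]
    simp [smul_smul, ← Circle.coe_inv_eq_conj]⟩
  map_one' := Subtype.ext (by simp)
  map_mul' z w := Subtype.ext (by simp [smul_smul, mul_comm])

lemma _root_.List.prod_ofFn_zpow_mul {G : Type*} [Group G] (c : G) (hc : ∀ g, Commute c g) {m : ℕ}
    (u : Fin m → G) (k : Fin m → ℤ) :
    (List.ofFn fun j => (c * u j) ^ k j).prod =
      c ^ (∑ j, k j) * (List.ofFn fun j => u j ^ k j).prod := by
  induction m with
  | zero => simp
  | succ m ih =>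
    rw [List.ofFn_succ, List.prod_cons, ih, List.ofFn_succ, List.prod_cons, Fin.sum_univ_succ,
      (hc (u 0)).mul_zpow, zpow_add, mul_assoc, mul_assoc, ← mul_assoc (u 0 ^ k 0),
      ← ((hc (u 0)).zpow_zpow (∑ j : Fin m, k j.succ) (k 0)).eq, mul_assoc]

lemma regularHom_monomial (α : Fin n → ℤ) : regularHom θ (monomial θ α) =
    ((List.ofFn fun j => regularU θ j ^ α j).prod : unitary (Ell2 n →L[ℂ] Ell2 n)) := by
  let G : unitary (QuantumTorus θ) →* unitary (Ell2 n →L[ℂ] Ell2 n) :=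
    { toFun := fun v => ⟨regularHom θ (v : QuantumTorus θ), Unitary.map_mem (regularHom θ) v.2⟩
      map_one' := Subtype.ext (map_one (regularHom θ))
      map_mul' := fun v w => Subtype.ext (map_mul (regularHom θ) (v : QuantumTorus θ) w) }
  have h0 : ∀ j, G (U θ j) = regularU θ j := fun j => rfl
  have : G (List.ofFn fun j => U θ j ^ α j).prod =
      (List.ofFn fun j => regularU θ j ^ α j).prod := by
    rw [map_list_prod, List.map_ofFn]
    congr 2
    ext1 j
    rw [Function.comp_apply, map_zpow, h0]
  rw [← this]
  rfl

lemma gaugeUnitary_mul_monomial (z : Circle) (α : Fin n → ℤ) :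
    (gaugeUnitary n z : Ell2 n →L[ℂ] Ell2 n) * regularHom θ (monomial θ α) =
      ((z ^ ∑ j, α j : Circle) : ℂ) •
        (regularHom θ (monomial θ α) * (gaugeUnitary n z : Ell2 n →L[ℂ] Ell2 n)) := by
  have hc : ∀ w : Circle, ∀ g : unitary (Ell2 n →L[ℂ] Ell2 n), Commute (circleUnitary w) g :=
    fun w g => Subtype.ext (by simp [circleUnitary])
  -- Conjugation is a group automorphism multiplying each generator by a central scalar, so the
  -- scalars collect to `z^(∑ α_j)`.
  have hu : ∀ j, MulAut.conj (gaugeUnitary n z) (regularU θ j) = circleUnitary z * regularU θ j := by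
    intro j
    rw [MulAut.conj_apply, mul_inv_eq_iff_eq_mul]
    apply Subtype.ext
    have := gaugeUnitary_mul_regularU θ z j
    simpa [circleUnitary] using this
  have h : MulAut.conj (gaugeUnitary n z) (List.ofFn fun j => regularU θ j ^ α j).prod =
      circleUnitary (z ^ ∑ j, α j) * (List.ofFn fun j => regularU θ j ^ α j).prod := by
    rw [map_zpow, ← List.prod_ofFn_zpow_mul _ (hc z), map_list_prod, List.map_ofFn]
    congr 2
    ext1 j
    rw [Function.comp_apply, map_zpow, hu]
  rw [MulAut.conj_apply, mul_inv_eq_iff_eq_mul] at h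
  have := congrArg Subtype.val h
  rw [regularHom_monomial]
  simpa [circleUnitary] using this

lemma torusLpNorm_monomial {p : ℝ≥0∞} (hp : 1 ≤ p) (α : Fin n → ℤ) :
    torusLpNorm θ p (monomial θ α) = 1 := by
  by_cases h : p = ∞
  · subst h
    rw [torusLpNorm_top, regularHom_monomial]
    exact CStarRing.norm_coe_unitary _
  · have h1 : star (monomial θ α) * monomial θ α = 1 := Unitary.coe_star_mul_self _
    have h2 : trace θ 1 = 1 := by
      rw [trace_apply, map_one]
      exact (inner_delta 0 0).trans (if_pos rfl)
    rw [torusLpNorm_of_ne_top θ h, powerTrace, h1, cfc_apply_one]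
    simp [reTrace_apply, h2]

end QTorus

/-! ### The Fejér kernel and gauge-invariant multiplier bounds. -/

namespace QTorus

open Filter Topology

/-- The Fejér kernel, discretized: `D - m`, `0 ≤ m ≤ D`, is a positive combination of total mass `D`
of characters. -/
lemma exists_fejer_weights (D : ℕ) : ∃ (M : ℕ) (w : Fin M → ℝ) (z : Fin M → Circle),
    (∀ i, 0 ≤ w i) ∧ ∑ i, w i = D ∧
      ∀ m : ℕ, m ≤ D → ∑ i, (w i : ℂ) * (z i : ℂ) ^ m = (D : ℂ) - m := by
  rcases Nat.eq_zero_or_pos D with rfl | hD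
  · exact ⟨0, fun _ => 0, fun _ => 1, by simp, by simp, fun m hm => by simp_all⟩
  -- For `a, b < D` and `m ≤ D` both `a + m` and `b` are below `2 D`, so roots of unity of this
  -- order cause no aliasing.
  set M := 2 * D with hM
  have hM0 : M ≠ 0 := by omega
  have hMC : (M : ℂ) ≠ 0 := by exact_mod_cast hM0
  set ω : Circle := Circle.exp (2 * Real.pi / M) with hω
  have hprim : IsPrimitiveRoot (ω : ℂ) M := by
    have := Complex.isPrimitiveRoot_exp M hM0
    rw [hω, Circle.coe_exp]
    convert this using 2
    push_cast
    ring
  -- As squared moduli these are nonnegative. Expanding and using orthogonality counts the pairs `a,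
  -- b < D` with `a + m = b`, of which there are `D - m`.
  let w : Fin M → ℝ := fun j => ‖∑ a ∈ Finset.range D, ((ω : ℂ) ^ a) ^ (j : ℕ)‖ ^ 2 / M
  have key : ∀ m : ℕ, m ≤ D →
      ∑ i, (w i : ℂ) * ((ω ^ (i : ℕ) : Circle) : ℂ) ^ m = (D : ℂ) - m := by
    intro m hm
    have h1 : ∀ i : Fin M, (w i : ℂ) * ((ω ^ (i : ℕ) : Circle) : ℂ) ^ m =
        ∑ a ∈ Finset.range D, ∑ b ∈ Finset.range D,
          ((ω : ℂ) ^ a * ((ω : ℂ) ^ b)⁻¹ * (ω : ℂ) ^ m) ^ (i : ℕ) / M := by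
      intro i
      have : (w i : ℂ) = (∑ a ∈ Finset.range D, ((ω : ℂ) ^ a) ^ (i : ℕ)) *
          (∑ b ∈ Finset.range D, (((ω : ℂ) ^ b)⁻¹) ^ (i : ℕ)) / M := by
        simp only [w]
        push_cast
        rw [← Complex.mul_conj', map_sum]
        congr 2
        refine Finset.sum_congr rfl fun b _ => ?_
        rw [map_pow, map_pow, ← Circle.coe_inv_eq_conj, Circle.coe_inv, inv_pow]
      rw [this, Finset.sum_mul_sum, Finset.sum_div, Finset.sum_mul]
      refine Finset.sum_congr rfl fun a _ => ?_
      rw [Finset.sum_div, Finset.sum_mul]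
      refine Finset.sum_congr rfl fun b _ => ?_
      rw [Circle.coe_pow, mul_pow, mul_pow, ← pow_mul (ω : ℂ) i m, ← pow_mul (ω : ℂ) m i,
        mul_comm (i : ℕ) m]
      ring
    have h2 : ∀ a ∈ Finset.range D, ∀ b ∈ Finset.range D,
        ∑ i : Fin M, ((ω : ℂ) ^ a * ((ω : ℂ) ^ b)⁻¹ * (ω : ℂ) ^ m) ^ (i : ℕ) / M =
          if a + m = b then 1 else 0 := by
      intro a ha b hb
      rw [Finset.mem_range] at ha hb
      have hne : ∀ k : ℕ, (ω : ℂ) ^ k ≠ 0 := fun k => pow_ne_zero _ (Circle.coe_ne_zero ω)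
      rw [Fin.sum_univ_eq_sum_range (fun i : ℕ =>
        ((ω : ℂ) ^ a * ((ω : ℂ) ^ b)⁻¹ * (ω : ℂ) ^ m) ^ i / M), ← Finset.sum_div]
      have hz : (ω : ℂ) ^ a * ((ω : ℂ) ^ b)⁻¹ * (ω : ℂ) ^ m = 1 ↔ a + m = b := by
        rw [mul_right_comm, ← pow_add, mul_inv_eq_one₀ (hne b)]
        exact ⟨fun h => hprim.pow_inj (by omega) (by omega) h, fun h => by rw [h]⟩
      split_ifs with h
      · rw [hz.2 h]
        simp [hMC]
      · have hζ := mt hz.1 h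
        set ζ := (ω : ℂ) ^ a * ((ω : ℂ) ^ b)⁻¹ * (ω : ℂ) ^ m
        have hζM : ζ ^ M = 1 := by
          simp only [ζ, mul_pow, inv_pow, ← pow_mul, mul_comm _ M]
          simp [pow_mul, hprim.pow_eq_one]
        rw [geom_sum_eq hζ, hζM]
        simp
    rw [Finset.sum_congr rfl fun i _ => h1 i, Finset.sum_comm]
    have h3 : ∀ a ∈ Finset.range D, (∑ i : Fin M, ∑ b ∈ Finset.range D,
        ((ω : ℂ) ^ a * ((ω : ℂ) ^ b)⁻¹ * (ω : ℂ) ^ m) ^ (i : ℕ) / M) =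
          if a < D - m then 1 else 0 := by
      intro a ha
      rw [Finset.sum_comm, Finset.sum_congr rfl fun b hb => h2 a ha b hb, Finset.sum_ite_eq]
      congr 1
      rw [Finset.mem_range]
      exact propext (by omega)
    rw [Finset.sum_congr rfl h3, ← Finset.sum_filter, Finset.sum_const]
    have : (Finset.range D).filter (· < D - m) = Finset.range (D - m) := by
      ext a
      simp only [Finset.mem_filter, Finset.mem_range]
      omega
    rw [this, Finset.card_range, nsmul_one, Nat.cast_sub hm]
  refine ⟨M, w, fun i => ω ^ (i : ℕ), fun i => by positivity, ?_, key⟩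
  have := key 0 (Nat.zero_le _)
  simp only [pow_zero, mul_one, Nat.cast_zero, sub_zero] at this
  exact_mod_cast this

lemma seminorm_sum_le {E ι : Type*} [AddCommGroup E] [Module ℂ E] (N : Seminorm ℂ E)
    (s : Finset ι) (f : ι → E) : N (∑ i ∈ s, f i) ≤ ∑ i ∈ s, N (f i) :=
  Finset.le_sum_of_subadditive N (map_zero N).le (map_add_le_add N) s f

variable {n : ℕ} (θ : SkewMatrix n)

/-! ### Fourier multipliers -/

/-- The Fourier multiplier `∑ x_α U ^ α ↦ ∑ m α x_α U ^ α`. -/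
def multiplier (m : (Fin n → ℤ) → ℂ) : Poly θ →ₗ[ℂ] Poly θ :=
  (polyBasis θ).constr ℂ fun α => m α • polyBasis θ α

lemma coe_polyBasis (α : Fin n → ℤ) :
    (polyBasis θ α : QuantumTorus θ) = monomial θ α :=
  (congrArg Subtype.val (Module.Basis.span_apply (linearIndependent_monomial θ) α) :)

lemma multiplier_basis (m : (Fin n → ℤ) → ℂ) (α : Fin n → ℤ) :
    multiplier θ m (polyBasis θ α) = m α • polyBasis θ α :=
  (polyBasis θ).constr_basis _ _ _

lemma multiplier_eq_sum (m : (Fin n → ℤ) → ℂ) (x : Poly θ) :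
    multiplier θ m x = ∑ α ∈ ((polyBasis θ).repr x).support,
      (m α * (polyBasis θ).repr x α) • polyBasis θ α := by
  rw [multiplier, Module.Basis.constr_apply, Finsupp.sum]
  exact Finset.sum_congr rfl fun α _ => by rw [smul_smul, mul_comm]

lemma repr_multiplier (m : (Fin n → ℤ) → ℂ) (x : Poly θ) (α : Fin n → ℤ) :
    (polyBasis θ).repr (multiplier θ m x) α = m α * (polyBasis θ).repr x α := by
  rw [multiplier_eq_sum]
  simp only [map_sum, map_smul, Module.Basis.repr_self, Finsupp.coe_finsetSum, Finset.sum_apply,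
    Finsupp.smul_apply, Finsupp.single_apply, smul_eq_mul, mul_ite, mul_one, mul_zero,
    Finset.sum_ite_eq', Finsupp.mem_support_iff]
  split_ifs with h
  · rfl
  · rw [not_not.1 h, mul_zero]

lemma ext_repr {x y : Poly θ} (h : ∀ α, (polyBasis θ).repr x α = (polyBasis θ).repr y α) : x = y :=
  (polyBasis θ).repr.injective (Finsupp.ext h)

lemma generator_eq_multiplier : generator θ = multiplier θ fun α => (degree α : ℂ) := rfl

lemma semigroup_eq_multiplier (t : ℝ) :
    semigroup θ t = multiplier θ fun α => (Real.exp (-t * degree α) : ℂ) := rfl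

lemma of_repr_ne_zero_of_mem_span {P : (Fin n → ℤ) → Prop} {x : Poly θ}
    (hx : (x : QuantumTorus θ) ∈ Submodule.span ℂ {y | ∃ α, P α ∧ y = monomial θ α})
    {α : Fin n → ℤ} (hα : (polyBasis θ).repr x α ≠ 0) : P α := by
  have h : {y | ∃ α, P α ∧ y = monomial θ α} =
      (Poly θ).subtype '' (polyBasis θ '' {α | P α}) := by
    rw [Set.image_image]
    ext y
    exact exists_congr fun α => and_congr_right fun _ => by
      dsimp only
      rw [Submodule.subtype_apply, coe_polyBasis, eq_comm]
  rw [h, ← Submodule.map_span] at hx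
  obtain ⟨y, hy, hyx⟩ := hx
  obtain rfl : y = x := Subtype.ext hyx
  exact (polyBasis θ).mem_span_image.1 hy (Finsupp.mem_support_iff.2 hα)

/-- A seminorm on the polynomials that is invariant under the gauge action and normalized on the
monomials. -/
structure IsGaugeInvariant (N : Seminorm ℂ (Poly θ)) : Prop where
  gauge : ∀ (z : Circle) (x : Poly θ),
    N (multiplier θ (fun α => ((z ^ ∑ j, α j : Circle) : ℂ)) x) = N x
  basis : ∀ α, N (polyBasis θ α) = 1

namespace IsGaugeInvariant

variable {θ} {N : Seminorm ℂ (Poly θ)}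

lemma multiplier_le_sum (hN : IsGaugeInvariant θ N) (m : (Fin n → ℤ) → ℂ) (x : Poly θ) :
    N (multiplier θ m x) ≤ ∑ α ∈ ((polyBasis θ).repr x).support,
      ‖m α‖ * ‖(polyBasis θ).repr x α‖ := by
  rw [multiplier_eq_sum]
  refine (seminorm_sum_le N _ _).trans (Finset.sum_le_sum fun α _ => ?_)
  rw [map_smul_eq_mul, hN.basis, norm_mul, mul_one]

/-- A fixed polynomial has finitely many coefficients and monomials have seminorm one, so pointwise
convergence of symbols suffices. -/
lemma le_of_tendsto_multiplier (hN : IsGaugeInvariant θ N) {m : (Fin n → ℤ) → ℂ}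
    {f : ℕ → (Fin n → ℤ) → ℂ} (hf : ∀ α, Tendsto (fun k => f k α) atTop (𝓝 (m α))) {x : Poly θ}
    {C : ℝ} (hC : ∀ k, N (multiplier θ (f k) x) ≤ C) : N (multiplier θ m x) ≤ C := by
  have h1 : ∀ k, N (multiplier θ m x) ≤ C + ∑ α ∈ ((polyBasis θ).repr x).support,
      ‖m α - f k α‖ * ‖(polyBasis θ).repr x α‖ := by
    intro k
    have : multiplier θ m x = multiplier θ (f k) x + multiplier θ (fun α => m α - f k α) x :=
      ext_repr θ fun α => by
        rw [map_add, Finsupp.add_apply]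
        simp only [repr_multiplier]
        ring
    rw [this]
    exact (map_add_le_add N _ _).trans (add_le_add (hC k) (hN.multiplier_le_sum _ x))
  have h2 : Tendsto (fun k => C + ∑ α ∈ ((polyBasis θ).repr x).support,
      ‖m α - f k α‖ * ‖(polyBasis θ).repr x α‖) atTop
      (𝓝 (C + ∑ α ∈ ((polyBasis θ).repr x).support,
        ‖m α - m α‖ * ‖(polyBasis θ).repr x α‖)) :=
    tendsto_const_nhds.add (tendsto_finsetSum _ fun α _ =>
      ((tendsto_const_nhds.sub (hf α)).norm).mul_const _)
  simpa using ge_of_tendsto' h2 h1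

/-- Bernstein's inequality for polynomials whose frequencies lie in an interval. -/
lemma multiplier_sub_le (hN : IsGaugeInvariant θ N) (c ε : ℤ) (D : ℕ) {x : Poly θ}
    (hx : ∀ α, (polyBasis θ).repr x α ≠ 0 → 0 ≤ ε * (∑ j, α j - c) ∧ ε * (∑ j, α j - c) ≤ D) :
    N (multiplier θ (fun α => (D : ℂ) - (ε * (∑ j, α j - c) : ℤ)) x) ≤ D * N x := by
  obtain ⟨M, w, z, hw, hsum, hz⟩ := exists_fejer_weights D
  -- With `m = ε (∑ α_j - c)`, each `z_i^m` splits into the gauge symbol of `z_i^ε` and the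
  -- unimodular constant `z_i^(-ε c)`. The hypothesis places `m` in the range of the Fejér identity.
  have h : multiplier θ (fun α => (D : ℂ) - (ε * (∑ j, α j - c) : ℤ)) x =
      ∑ i, ((w i : ℂ) * ((z i ^ (-(ε * c)) : Circle) : ℂ)) •
        multiplier θ (fun α => (((z i ^ ε) ^ ∑ j, α j : Circle) : ℂ)) x := by
    refine ext_repr θ fun α => ?_
    simp only [map_sum, map_smul, Finsupp.coe_finsetSum, Finset.sum_apply, Finsupp.smul_apply,
      repr_multiplier, smul_eq_mul]
    by_cases hα : (polyBasis θ).repr x α = 0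
    · simp [hα]
    obtain ⟨h0, h1⟩ := hx α hα
    obtain ⟨k, hk⟩ := Int.eq_ofNat_of_zero_le h0
    simp only [← mul_assoc]
    rw [← Finset.sum_mul, hk]
    congr 1
    rw [Int.cast_natCast, ← hz k (by omega)]
    refine Finset.sum_congr rfl fun i _ => ?_
    rw [mul_assoc, ← Circle.coe_mul, ← Circle.coe_pow, ← zpow_mul, ← zpow_add, ← zpow_natCast, ← hk]
    congr 3
    ring
  rw [h]
  refine (seminorm_sum_le N _ _).trans (le_of_eq ?_)
  rw [← hsum, Finset.sum_mul]
  refine Finset.sum_congr rfl fun i _ => ?_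
  rw [map_smul_eq_mul, hN.gauge, norm_mul, Circle.norm_coe, mul_one, Complex.norm_real,
    Real.norm_of_nonneg (hw i)]

/-- The exponential series is bounded term by term. The bound is assumed for all `y` supported in
the support of `x` so that it can be iterated on powers of the multiplier. -/
lemma multiplier_exp_le (hN : IsGaugeInvariant θ N) {m : (Fin n → ℤ) → ℂ} {x : Poly θ} {D : ℝ}
    (hD : 0 ≤ D)
    (h : ∀ y : Poly θ, (∀ α, (polyBasis θ).repr y α ≠ 0 → (polyBasis θ).repr x α ≠ 0) →
      N (multiplier θ m y) ≤ D * N y) {t : ℝ} (ht : 0 ≤ t) :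
    N (multiplier θ (fun α => Complex.exp (t * m α)) x) ≤ Real.exp (t * D) * N x := by
  have hpow : ∀ k : ℕ, N (multiplier θ (fun α => m α ^ k) x) ≤ D ^ k * N x := by
    intro k
    induction k with
    | zero =>
      refine le_of_eq ?_
      rw [pow_zero, one_mul]
      congr 1
      exact ext_repr θ fun α => by simp [repr_multiplier]
    | succ k ih =>
      have e : multiplier θ (fun α => m α ^ (k + 1)) x =
          multiplier θ m (multiplier θ (fun α => m α ^ k) x) :=
        ext_repr θ fun α => by
          simp only [repr_multiplier]
          ring
      rw [e, pow_succ', mul_assoc]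
      refine (h _ fun α hα => ?_).trans (mul_le_mul_of_nonneg_left ih hD)
      rw [repr_multiplier] at hα
      exact right_ne_zero_of_mul hα
  refine hN.le_of_tendsto_multiplier
    (f := fun K α => ∑ k ∈ Finset.range K, (t * m α) ^ k / (k.factorial : ℂ)) (fun α => ?_) fun K => ?_
  · rw [Complex.exp_eq_exp_ℂ]
    exact (NormedSpace.expSeries_div_hasSum_exp (t * m α)).tendsto_sum_nat
  · have e : multiplier θ (fun α => ∑ k ∈ Finset.range K, (t * m α) ^ k / (k.factorial : ℂ)) x =
        ∑ k ∈ Finset.range K, ((t : ℂ) ^ k / (k.factorial : ℂ)) •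
          multiplier θ (fun α => m α ^ k) x := by
      refine ext_repr θ fun α => ?_
      simp only [map_sum, map_smul, Finsupp.coe_finsetSum, Finset.sum_apply, Finsupp.smul_apply,
        repr_multiplier, smul_eq_mul, Finset.sum_mul]
      exact Finset.sum_congr rfl fun k _ => by ring
    rw [e]
    refine (seminorm_sum_le N _ _).trans ?_
    refine le_trans ?_ (mul_le_mul_of_nonneg_right
      (Real.sum_le_exp_of_nonneg (mul_nonneg ht hD) K) (apply_nonneg N x))
    rw [Finset.sum_mul]
    refine Finset.sum_le_sum fun k _ => ?_
    rw [map_smul_eq_mul, norm_div, norm_pow, Complex.norm_real, Real.norm_of_nonneg ht,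
      Complex.norm_natCast, mul_pow]
    calc _ ≤ t ^ k / (k.factorial : ℝ) * (D ^ k * N x) :=
          mul_le_mul_of_nonneg_left (hpow k) (by positivity)
      _ = _ := by ring

end IsGaugeInvariant

end QTorus

/-! ### Gauge invariance of the `L_p`-norms and the four inequalities. -/

namespace QTorus

open Filter Topology

variable {n : ℕ} (θ : SkewMatrix n)

lemma regularHom_gauge (z : Circle) (x : Poly θ) :
    regularHom θ (multiplier θ (fun α => ((z ^ ∑ j, α j : Circle) : ℂ)) x : Poly θ) *
        (gaugeUnitary n z : Ell2 n →L[ℂ] Ell2 n) =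
      (gaugeUnitary n z : Ell2 n →L[ℂ] Ell2 n) * regularHom θ x := by
  have hx := (polyBasis θ).mem_span x
  induction hx using Submodule.span_induction with
  | mem x hx =>
    obtain ⟨α, rfl⟩ := hx
    rw [multiplier_basis, Submodule.coe_smul, coe_polyBasis, map_smul, smul_mul_assoc,
      gaugeUnitary_mul_monomial]
  | zero => simp
  | add x y _ _ hx hy =>
    rw [map_add, Submodule.coe_add, Submodule.coe_add, map_add, map_add, add_mul, mul_add, hx, hy]
  | smul c x _ hx =>
    rw [map_smul, Submodule.coe_smul, Submodule.coe_smul, map_smul, map_smul, smul_mul_assoc, hx,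
      mul_smul_comm]

lemma exists_isGaugeInvariant {p : ℝ≥0∞} (hp : 1 ≤ p) : ∃ N : Seminorm ℂ (Poly θ),
    IsGaugeInvariant θ N ∧ ∀ x : Poly θ, torusLpNorm θ p x = N x := by
  obtain ⟨N, hN⟩ := exists_seminorm_eq_torusLpNorm θ hp
  have hNx : ∀ x : Poly θ, N.comp (Poly θ).subtype x = torusLpNorm θ p x := fun x => hN x
  refine ⟨N.comp (Poly θ).subtype, ⟨fun z x => ?_, fun α => ?_⟩, fun x => (hNx x).symm⟩
  · rw [hNx, hNx]
    exact torusLpNorm_eq_of_conj θ (gaugeUnitary n z) (gaugeUnitary_delta_zero z)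
      (regularHom_gauge θ z x) p
  · rw [hNx, coe_polyBasis, torusLpNorm_monomial θ hp]

variable {θ}

lemma nonneg_of_mem_holomorphic {x : Poly θ} (hx : (x : QuantumTorus θ) ∈ holomorphic θ)
    {α : Fin n → ℤ} (hα : (polyBasis θ).repr x α ≠ 0) : ∀ j, 0 ≤ α j :=
  of_repr_ne_zero_of_mem_span θ hx hα

lemma le_degree_of_mem_tailSpace {d : ℕ} {x : Poly θ}
    (hx : (x : QuantumTorus θ) ∈ tailSpace θ d)
    {α : Fin n → ℤ} (hα : (polyBasis θ).repr x α ≠ 0) : d ≤ degree α :=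
  of_repr_ne_zero_of_mem_span θ hx hα

lemma degree_le_of_mem_lowSpace {d : ℕ} {x : Poly θ}
    (hx : (x : QuantumTorus θ) ∈ lowSpace θ d)
    {α : Fin n → ℤ} (hα : (polyBasis θ).repr x α ≠ 0) : degree α ≤ d :=
  of_repr_ne_zero_of_mem_span θ hx hα

lemma sum_eq_degree {α : Fin n → ℤ} (h : ∀ j, 0 ≤ α j) : ∑ j, α j = degree α := by
  rw [degree, Nat.cast_sum]
  exact Finset.sum_congr rfl fun j _ => by
    have := h j
    omega

lemma multiplier_congr {m m' : (Fin n → ℤ) → ℂ} {x : Poly θ}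
    (h : ∀ α, (polyBasis θ).repr x α ≠ 0 → m α = m' α) : multiplier θ m x = multiplier θ m' x :=
  ext_repr θ fun α => by
    rw [repr_multiplier, repr_multiplier]
    by_cases hα : (polyBasis θ).repr x α = 0
    · rw [hα, mul_zero, mul_zero]
    · rw [h α hα]

namespace IsGaugeInvariant

variable {N : Seminorm ℂ (Poly θ)}

/-- The reversed generator `B - L` has norm at most `B - d` on holomorphic polynomials with
degrees in `[d, B]`. -/
lemma multiplier_sub_degree_le (hN : IsGaugeInvariant θ N) {d B : ℕ} (hdB : d ≤ B) {x : Poly θ}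
    (hpos : ∀ α, (polyBasis θ).repr x α ≠ 0 → ∀ j, 0 ≤ α j)
    (hd : ∀ α, (polyBasis θ).repr x α ≠ 0 → d ≤ degree α)
    (hB : ∀ α, (polyBasis θ).repr x α ≠ 0 → degree α ≤ B) :
    N (multiplier θ (fun α => (B : ℂ) - degree α) x) ≤ ((B : ℝ) - d) * N x := by
  have h := hN.multiplier_sub_le d 1 (B - d) (x := x) fun α hα => by
    rw [sum_eq_degree (hpos α hα)]
    have := hd α hα
    have := hB α hα
    omega
  simp only [Nat.cast_sub hdB] at h
  convert h using 2
  refine multiplier_congr fun α hα => ?_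
  rw [sum_eq_degree (hpos α hα)]
  push_cast
  ring

/-- Bernstein's inequality for holomorphic polynomials. -/
lemma multiplier_degree_le (hN : IsGaugeInvariant θ N) {d : ℕ} {x : Poly θ}
    (hpos : ∀ α, (polyBasis θ).repr x α ≠ 0 → ∀ j, 0 ≤ α j)
    (hd : ∀ α, (polyBasis θ).repr x α ≠ 0 → degree α ≤ d) :
    N (multiplier θ (fun α => (degree α : ℂ)) x) ≤ d * N x := by
  -- The reflection `ε = -1` about `c = d` turns `D - m` into the degree itself.
  have h := hN.multiplier_sub_le d (-1) d (x := x) fun α hα => by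
    rw [sum_eq_degree (hpos α hα)]
    have := hd α hα
    omega
  convert h using 2
  refine multiplier_congr fun α hα => ?_
  rw [sum_eq_degree (hpos α hα)]
  push_cast
  ring

lemma exists_degree_bound (x : Poly θ) (d : ℕ) :
    ∃ B, d ≤ B ∧ ∀ α, (polyBasis θ).repr x α ≠ 0 → degree α ≤ B :=
  ⟨max d (((polyBasis θ).repr x).support.sup degree), le_max_left _ _, fun _ hα =>
    (Finset.le_sup (f := degree) (Finsupp.mem_support_iff.2 hα)).trans (le_max_right _ _)⟩

lemma le_generator_of_le_degree (hN : IsGaugeInvariant θ N) {d : ℕ} {x : Poly θ}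
    (hpos : ∀ α, (polyBasis θ).repr x α ≠ 0 → ∀ j, 0 ≤ α j)
    (hd : ∀ α, (polyBasis θ).repr x α ≠ 0 → d ≤ degree α) :
    d * N x ≤ N (generator θ x) := by
  obtain ⟨B, hdB, hB⟩ := exists_degree_bound x d
  have h := hN.multiplier_sub_degree_le hdB hpos hd hB
  have e : (B : ℂ) • x = generator θ x + multiplier θ (fun α => (B : ℂ) - degree α) x :=
    ext_repr θ fun α => by
      rw [generator_eq_multiplier, map_add, map_smul, Finsupp.add_apply, Finsupp.smul_apply,
        smul_eq_mul, repr_multiplier, repr_multiplier]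
      ring
  have h2 := map_add_le_add N (generator θ x) (multiplier θ (fun α => (B : ℂ) - degree α) x)
  rw [← e, map_smul_eq_mul, Complex.norm_natCast] at h2
  linarith

lemma semigroup_le_of_le_degree (hN : IsGaugeInvariant θ N) {d : ℕ} {x : Poly θ}
    (hpos : ∀ α, (polyBasis θ).repr x α ≠ 0 → ∀ j, 0 ≤ α j)
    (hd : ∀ α, (polyBasis θ).repr x α ≠ 0 → d ≤ degree α) {t : ℝ} (ht : 0 ≤ t) :
    N (semigroup θ t x) ≤ Real.exp (-t * d) * N x := by
  obtain ⟨B, hdB, hB⟩ := exists_degree_bound x d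
  have h := hN.multiplier_exp_le (m := fun α => (B : ℂ) - degree α) (x := x)
    (sub_nonneg.2 (Nat.cast_le.2 hdB) : (0 : ℝ) ≤ B - d)
    (fun y hy => hN.multiplier_sub_degree_le hdB (fun α hα => hpos α (hy α hα))
      (fun α hα => hd α (hy α hα)) fun α hα => hB α (hy α hα)) ht
  have e : semigroup θ t x = (Real.exp (-t * B) : ℂ) •
      multiplier θ (fun α => Complex.exp (t * ((B : ℂ) - degree α))) x :=
    ext_repr θ fun α => by
      rw [semigroup_eq_multiplier, map_smul, Finsupp.smul_apply, smul_eq_mul, repr_multiplier,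
        repr_multiplier, ← mul_assoc]
      push_cast
      rw [← Complex.exp_add]
      ring_nf
  rw [e, map_smul_eq_mul, Complex.norm_real, Real.norm_of_nonneg (Real.exp_pos _).le]
  refine (mul_le_mul_of_nonneg_left h (Real.exp_pos _).le).trans_eq ?_
  rw [← mul_assoc, ← Real.exp_add]
  ring_nf

lemma le_semigroup_of_degree_le (hN : IsGaugeInvariant θ N) {d : ℕ} {x : Poly θ}
    (hpos : ∀ α, (polyBasis θ).repr x α ≠ 0 → ∀ j, 0 ≤ α j)
    (hd : ∀ α, (polyBasis θ).repr x α ≠ 0 → degree α ≤ d) {t : ℝ} (ht : 0 ≤ t) :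
    Real.exp (-t * d) * N x ≤ N (semigroup θ t x) := by
  have hsupp : ∀ α, (polyBasis θ).repr (semigroup θ t x) α ≠ 0 → (polyBasis θ).repr x α ≠ 0 :=
    fun α hα => by
      rw [semigroup_eq_multiplier, repr_multiplier] at hα
      exact right_ne_zero_of_mul hα
  -- The estimate for `e^{tL}` is applied to `P_t x`, from which it recovers `x`.
  have h := hN.multiplier_exp_le (m := fun α => (degree α : ℂ)) (x := semigroup θ t x)
    (Nat.cast_nonneg d : (0 : ℝ) ≤ d)
    (fun y hy => hN.multiplier_degree_le (fun α hα => hpos α (hsupp α (hy α hα)))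
      fun α hα => hd α (hsupp α (hy α hα))) ht
  have e : multiplier θ (fun α => Complex.exp (t * (degree α : ℂ))) (semigroup θ t x) = x :=
    ext_repr θ fun α => by
      rw [semigroup_eq_multiplier, repr_multiplier, repr_multiplier, ← mul_assoc]
      push_cast
      rw [← Complex.exp_add]
      simp
  rw [e] at h
  refine (mul_le_mul_of_nonneg_left h (Real.exp_pos (-t * d)).le).trans_eq ?_
  rw [← mul_assoc, ← Real.exp_add]
  simp

end IsGaugeInvariant

end QTorus

end

theorem theorem6 (n : ℕ) (hn : 1 ≤ n) (θ : Matrix (Fin n) (Fin n) ℝ) (hθ : θᵀ = -θ)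
    (d : ℕ) (hd : 1 ≤ d) (p : ℝ≥0∞) (hp : 1 ≤ p) :
    -- holomorphic polynomials in the tail space
    (∀ x : QTorus.Poly ⟨θ, hθ⟩,
      (x : QTorus.QuantumTorus ⟨θ, hθ⟩) ∈ QTorus.holomorphic ⟨θ, hθ⟩ →
      (x : QTorus.QuantumTorus ⟨θ, hθ⟩) ∈ QTorus.tailSpace ⟨θ, hθ⟩ d →
        (∀ t : ℝ, 0 ≤ t →
          QTorus.torusLpNorm ⟨θ, hθ⟩ p (QTorus.semigroup ⟨θ, hθ⟩ t x) ≤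
            Real.exp (-t * d) * QTorus.torusLpNorm ⟨θ, hθ⟩ p x) ∧
        d * QTorus.torusLpNorm ⟨θ, hθ⟩ p x ≤
          QTorus.torusLpNorm ⟨θ, hθ⟩ p (QTorus.generator ⟨θ, hθ⟩ x)) ∧
    -- holomorphic polynomials of low degree
    (∀ x : QTorus.Poly ⟨θ, hθ⟩,
      (x : QTorus.QuantumTorus ⟨θ, hθ⟩) ∈ QTorus.holomorphic ⟨θ, hθ⟩ →
      (x : QTorus.QuantumTorus ⟨θ, hθ⟩) ∈ QTorus.lowSpace ⟨θ, hθ⟩ d →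
        QTorus.torusLpNorm ⟨θ, hθ⟩ p (QTorus.generator ⟨θ, hθ⟩ x) ≤
          d * QTorus.torusLpNorm ⟨θ, hθ⟩ p x ∧
        (∀ t : ℝ, 0 ≤ t →
          Real.exp (-t * d) * QTorus.torusLpNorm ⟨θ, hθ⟩ p x ≤
            QTorus.torusLpNorm ⟨θ, hθ⟩ p (QTorus.semigroup ⟨θ, hθ⟩ t x))) ∧
    -- sharpness: some nonzero element of both spaces gives equality everywhere
    (∃ x : QTorus.Poly ⟨θ, hθ⟩,
      (x : QTorus.QuantumTorus ⟨θ, hθ⟩) ∈ QTorus.holomorphic ⟨θ, hθ⟩ ∧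
      (x : QTorus.QuantumTorus ⟨θ, hθ⟩) ∈ QTorus.tailSpace ⟨θ, hθ⟩ d ∧
      (x : QTorus.QuantumTorus ⟨θ, hθ⟩) ∈ QTorus.lowSpace ⟨θ, hθ⟩ d ∧
      0 < QTorus.torusLpNorm ⟨θ, hθ⟩ p x ∧
      (∀ t : ℝ, 0 ≤ t →
        QTorus.torusLpNorm ⟨θ, hθ⟩ p (QTorus.semigroup ⟨θ, hθ⟩ t x) =
          Real.exp (-t * d) * QTorus.torusLpNorm ⟨θ, hθ⟩ p x) ∧
      QTorus.torusLpNorm ⟨θ, hθ⟩ p (QTorus.generator ⟨θ, hθ⟩ x) =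
        d * QTorus.torusLpNorm ⟨θ, hθ⟩ p x) := by
  obtain ⟨N, hN, hNp⟩ := QTorus.exists_isGaugeInvariant ⟨θ, hθ⟩ hp
  simp only [hNp]
  refine ⟨fun x hx hxd => ?_, fun x hx hxd => ?_, ?_⟩
  · have hpos := fun α hα => QTorus.nonneg_of_mem_holomorphic hx (α := α) hα
    have hd' := fun α hα => QTorus.le_degree_of_mem_tailSpace hxd (α := α) hα
    exact ⟨fun t ht => hN.semigroup_le_of_le_degree hpos hd' ht,
      hN.le_generator_of_le_degree hpos hd'⟩
  · have hpos := fun α hα => QTorus.nonneg_of_mem_holomorphic hx (α := α) hα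
    have hd' := fun α hα => QTorus.degree_le_of_mem_lowSpace hxd (α := α) hα
    exact ⟨hN.multiplier_degree_le hpos hd', fun t ht => hN.le_semigroup_of_degree_le hpos hd' ht⟩
  -- The witness is `U_1^d`, an eigenvector of `L` with eigenvalue `d`.
  · let α : Fin n → ℤ := Pi.single ⟨0, hn⟩ d
    have hα : QTorus.degree α = d := by
      rw [QTorus.degree, Finset.sum_eq_single ⟨0, hn⟩]
      · simp [α]
      · intro j _ hj
        simp [α, hj]
      · simp
    have hα0 : ∀ j, 0 ≤ α j := fun j => by
      by_cases hj : j = ⟨0, hn⟩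
      · subst hj
        simp [α]
      · simp [α, hj]
    have hb := QTorus.coe_polyBasis ⟨θ, hθ⟩ α
    refine ⟨QTorus.polyBasis ⟨θ, hθ⟩ α, Submodule.subset_span ⟨α, hα0, hb⟩,
      Submodule.subset_span ⟨α, hα.ge, hb⟩, Submodule.subset_span ⟨α, hα.le, hb⟩, ?_, fun t _ => ?_, ?_⟩
    · rw [hN.basis]
      exact one_pos
    · rw [QTorus.semigroup_eq_multiplier, QTorus.multiplier_basis, map_smul_eq_mul, hα,
        Complex.norm_real, Real.norm_of_nonneg (Real.exp_pos _).le]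
    · rw [QTorus.generator_eq_multiplier, QTorus.multiplier_basis, map_smul_eq_mul, hα,
        Complex.norm_natCast]
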